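/- Fix $\theta>0$. For $x\ge 0$ and $y,z>0$ let $$p_x(y)=\frac{1}{\theta^2x+1}\,e^{-y/(\theta^2x+1)},\qquad q_x(z)=\frac{1}{x+1}\,e^{-z/(x+1)}$$ be the transition densities of two channels $w_{Y|X}$ and $w_{Z|X}$ from $[0,\infty)$ to $[0,\infty)$. For a Borel probability measure $\mu$ on $[0,\infty)$ let $w_{Y|X}\circ\mu$ and $w_{Z|X}\circ\mu$ be the output laws, with densities $\int p_x(y)\,d\mu(x)$ and $\int q_x(z)\,d\mu(x)$, let $I(\mu,w_{Y|X})$ be the mutual information between the input and the output of $w_{Y|X}$ when the input has law $\mu$, and let $\mathbb D(\cdot\|\cdot)$ be relative entropy (natural logarithms). Let $\Omega$ be the set of all $\mu$ with $\mathbb D(w_{Z|X}\circ\mu\|q_0)<\infty$, and for $\nu>0$ put $$A(\nu)=\sup\{I(\mu,w_{Y|X}) : \mu\in\Omega,\ \mathbb D(w_{Z|X}\circ\mu\|q_0)\le\nu\}.$$ Then $I(\mu,w_{Y|X})<\infty$ for all $\mu\in\Omega$, $A(\nu)<\infty$ for all $\nu>0$, and for every $\nu>0$ the supremum is attained by exactly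 one measure $\mu^*_\nu$. Moreover there is a function $\gamma:(0,\infty)\to[0,\infty)$ with the following properties. For $\nu>0$, $\mu_1\in\Omega$ and $x\ge0$ define $$w(x,\mu_1,\nu)=\int_0^\infty p_x(y)\log\frac{p_x(y)}{(w_{Y|X}\circ\mu_1)(y)}\,dy-\gamma(\nu)\left(\int_0^\infty q_x(z)\log\frac{(w_{Z|X}\circ\mu_1)(z)}{q_0(z)}\,dz-\nu\right);$$ both integrals converge absolutely, and $w(\cdot,\mu_1,\nu)$ is integrable with respect to every $\mu\in\Omega$. 1. For every $\nu>0$, $$A(\nu)=\max_{\mu\in\Omega}\left[I(\mu,w_{Y|X})-\gamma(\nu)\left(\mathbb D(w_{Z|X}\circ\mu\|q_0)-\nu\right)\right],$$ and $\mu^*_\nu$ is the unique maximizer. 2. For every $\nu>0$ and every $\mu\in\Omega$, $A(\nu)\ge\mathbb E_\mu[w(X,\mu^*_\nu,\nu)]$. 3. For every $\nu>0$ and every $\mu_1\in\Omega$, the inequality $A(\nu)\ge\mathbb E_\mu[w(X,\mu_1,\nu)]$ holds for all $\mu\in\Omega$ if and only if $w(x,\mu_1,\nu)\le A(\nu)$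 for all $x\ge0$ and $w(x,\mu_1,\nu)=A(\nu)$ for all $x\in\operatorname{supp}\mu_1$. These pointwise conditions hold if and only if $\mu_1=\mu^*_\nu$. 4. $\lim_{\nu\to0^+}\gamma(\nu)=\infty$ and $\lim_{\nu\to0^+}\gamma(\nu)\,\nu=0$. -/

import Mathlib

open MeasureTheory ProbabilityTheory InformationTheory Filter Topology
open scoped ENNReal NNReal

noncomputable section

namespace CovertRayleigh

/-- The transition density `y ↦ exp (-y / (θ² x + 1)) / (θ² x + 1)` of the (squared-magnitude)
non-coherent Rayleigh-fading channel with fading parameter `θ`, for `y ≥ 0` and input `x ≥ 0`. -/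
def density (θ : ℝ) (x : ℝ≥0) (y : ℝ) : ℝ :=
  1 / (θ ^ 2 * (x : ℝ) + 1) * Real.exp (-y / (θ ^ 2 * (x : ℝ) + 1))

theorem density_nonneg (θ : ℝ) (x : ℝ≥0) (y : ℝ) : 0 ≤ density θ x y := by
  unfold density
  positivity

theorem measurable_density (θ : ℝ) :
    Measurable (fun p : ℝ≥0 × ℝ => density θ p.1 p.2) := by
  unfold density
  fun_prop

/-- The channel with input alphabet `[0, ∞)`: the input `x` is mapped to the law on the real line
with density `density θ x` on the positive half-line. -/
def channel (θ : ℝ) : Kernel ℝ≥0 ℝ where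
  toFun x := (volume.restrict (Set.Ioi (0 : ℝ))).withDensity
    (fun y => ENNReal.ofReal (density θ x y))
  measurable' := by
    refine Measure.measurable_of_measurable_coe _ (fun s hs => ?_)
    simp only [withDensity_apply _ hs]
    exact (measurable_density θ).ennreal_ofReal.lintegral_prod_right'

instance isMarkovKernel_channel (θ : ℝ) : IsMarkovKernel (channel θ) := by
  refine ⟨fun x => ⟨?_⟩⟩
  have hc : 0 < θ ^ 2 * (x : ℝ) + 1 := by positivity
  have hneg : -(1 / (θ ^ 2 * (x : ℝ) + 1)) < 0 := by
    have : 0 < 1 / (θ ^ 2 * (x : ℝ) + 1) := by positivity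
    linarith
  have hfun : density θ x = fun y : ℝ =>
      1 / (θ ^ 2 * (x : ℝ) + 1) * Real.exp (-(1 / (θ ^ 2 * (x : ℝ) + 1)) * y) := by
    funext y
    unfold density
    congr 2
    ring
  have hint : IntegrableOn (density θ x) (Set.Ioi 0) := by
    rw [hfun]
    exact (integrableOn_exp_mul_Ioi hneg 0).const_mul _
  have hval : ∫ y in Set.Ioi (0 : ℝ), density θ x y = 1 := by
    rw [hfun, integral_const_mul, integral_exp_mul_Ioi hneg 0]
    simp only [mul_zero, Real.exp_zero]
    field_simp
  change (volume.restrict (Set.Ioi (0 : ℝ))).withDensity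
    (fun y => ENNReal.ofReal (density θ x y)) Set.univ = 1
  rw [withDensity_apply _ MeasurableSet.univ, Measure.restrict_univ,
    ← ofReal_integral_eq_lintegral_ofReal hint
      (Filter.Eventually.of_forall (density_nonneg θ x)), hval, ENNReal.ofReal_one]

/-- The output law `w ∘ μ` of the channel with parameter `θ` when the input law is `μ`. -/
def outputLaw (θ : ℝ) (μ : ProbabilityMeasure ℝ≥0) : Measure ℝ :=
  (μ : Measure ℝ≥0).bind (channel θ)

/-- The density `y ↦ ∫ w(y|x) dμ(x)` of the output law. -/
def outputDensity (θ : ℝ) (μ : ProbabilityMeasure ℝ≥0) (y : ℝ) : ℝ :=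
  ∫ x, density θ x y ∂(μ : Measure ℝ≥0)

/-- The mutual information `I(μ, w_{Y|X})` between input and output of the channel with
parameter `θ`: the relative entropy of the joint law with respect to the product of its
marginals (natural logarithm). -/
def mutualInfo (θ : ℝ) (μ : ProbabilityMeasure ℝ≥0) : ℝ≥0∞ :=
  klDiv ((μ : Measure ℝ≥0).compProd (channel θ)) ((μ : Measure ℝ≥0).prod (outputLaw θ μ))

/-- The relative entropy `D(w_{Z|X} ∘ μ ‖ q₀)`. The channel of the warden is the one with
parameter `1`, and `q₀` is its output law for the input `0`. -/
def wardenDiv (μ : ProbabilityMeasure ℝ≥0) : ℝ≥0∞ :=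
  klDiv (outputLaw 1 μ) (channel 1 0)

/-- The set `Ω` of all input laws `μ` with `D(w_{Z|X} ∘ μ ‖ q₀) < ∞`. -/
def inputLaws : Set (ProbabilityMeasure ℝ≥0) :=
  {μ | wardenDiv μ < ∞}

/-- The input laws `μ ∈ Ω` with `D(w_{Z|X} ∘ μ ‖ q₀) ≤ ν`. -/
def feasible (ν : ℝ) : Set (ProbabilityMeasure ℝ≥0) :=
  {μ | μ ∈ inputLaws ∧ wardenDiv μ ≤ ENNReal.ofReal ν}

/-- `A(ν)`, the supremum of `I(μ, w_{Y|X})` over all `μ ∈ Ω` with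
`D(w_{Z|X} ∘ μ ‖ q₀) ≤ ν`. -/
def optValue (θ ν : ℝ) : ℝ≥0∞ :=
  ⨆ μ ∈ feasible ν, mutualInfo θ μ

/-- `μ` attains the supremum that defines `A(ν)`. -/
def IsOptimal (θ ν : ℝ) (μ : ProbabilityMeasure ℝ≥0) : Prop :=
  μ ∈ feasible ν ∧ mutualInfo θ μ = optValue θ ν

/-- The Lagrangian `I(μ, w_{Y|X}) - g (D(w_{Z|X} ∘ μ ‖ q₀) - ν)` with multiplier `g`. -/
def lagrangian (θ ν g : ℝ) (μ : ProbabilityMeasure ℝ≥0) : ℝ :=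
  (mutualInfo θ μ).toReal - g * ((wardenDiv μ).toReal - ν)

/-- The integrand `p_x(y) log (p_x(y) / (w_{Y|X} ∘ μ₁)(y))`. -/
def mainIntegrand (θ : ℝ) (μ₁ : ProbabilityMeasure ℝ≥0) (x : ℝ≥0) (y : ℝ) : ℝ :=
  density θ x y * Real.log (density θ x y / outputDensity θ μ₁ y)

/-- The integrand `q_x(z) log ((w_{Z|X} ∘ μ₁)(z) / q₀(z))`. -/
def wardenIntegrand (μ₁ : ProbabilityMeasure ℝ≥0) (x : ℝ≥0) (z : ℝ) : ℝ :=
  density 1 x z * Real.log (outputDensity 1 μ₁ z / density 1 0 z)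

/-- The function `w(x, μ₁, ν)`, with `g` the value `γ(ν)` of the multiplier. -/
def kktFun (θ ν g : ℝ) (μ₁ : ProbabilityMeasure ℝ≥0) (x : ℝ≥0) : ℝ :=
  (∫ y in Set.Ioi (0 : ℝ), mainIntegrand θ μ₁ x y)
    - g * ((∫ z in Set.Ioi (0 : ℝ), wardenIntegrand μ₁ x z) - ν)

/-- The pointwise conditions on `μ₁`: `w(x, μ₁, ν) ≤ A(ν)` for all `x ≥ 0`, and
`w(x, μ₁, ν) = A(ν)` for all `x` in the support of `μ₁`. -/
def PointwiseKKT (θ ν g : ℝ) (μ₁ : ProbabilityMeasure ℝ≥0) : Prop :=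
  (∀ x : ℝ≥0, kktFun θ ν g μ₁ x ≤ (optValue θ ν).toReal) ∧
    ∀ x ∈ (μ₁ : Measure ℝ≥0).support, kktFun θ ν g μ₁ x = (optValue θ ν).toReal

end CovertRayleigh

end

/-! Write f_μ for the output density of an input law μ and H(μ,ρ) = ∫ f_μ log f_ρ (`cross`). Every
f_ρ lies between c e^{-y} and 1, so log f_ρ grows at most linearly and every integral converges as
soon as the input has a mean. Having a mean is equivalent to lying in Ω (`mem_inputLaws_iff`).

On Ω the mutual information is an affine functional of μ minus H(μ,μ), and the warden's divergence
is an affine functional plus H(μ,μ) for the channel with parameter 1. Replacing H(μ,μ) by H(μ,ρ) in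
the Lagrangian L(μ) gives K(μ,ρ) = E_μ[w(X,ρ,ν)] (`kktMean`), which is affine in μ. Gibbs'
inequality H(μ,ρ) ≤ H(μ,μ) then gives L(μ) ≤ K(μ,ρ) for g ≥ 0, with equality only for μ = ρ, because
the output density determines the input law (`eq_of_outputDensity_eq`). Since L(μ) = K(μ,μ), L is a
minimum of affine functionals: this one fact yields concavity, uniqueness of the maximizer and the
optimality conditions.

An optimal law exists because a bound on the divergence bounds the mean, which gives tightness, and
Fatou's lemma gives the semicontinuity of both functionals. The multiplier is a slope separating the
two sides of the constraint (`exists_multiplier`). At a maximizer μ₀, L along (1-t)μ₀ + tμ is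
compared with L(μ₀) and t tends to 0, giving K(μ,μ₀) ≤ L(μ₀). Conversely, if K(·,μ₁) ≤ A, then
K(μ*,μ₁) ≤ A = L(μ*) is the equality case of Gibbs, so μ₁ = μ*. Dirac test laws and continuity of w
turn the averaged condition into the pointwise one.

For the limits, A(ν) ≤ θ²(2√ν + ν). Testing with δ₀ gives γ(ν)ν ≤ A(ν). The divergence has
derivative zero at δ₀ towards δ₁ while the information has a positive one, so no bounded price
suffices as ν → 0. -/

noncomputable section

namespace CovertRayleigh

/-! ### Bounds on output densities and convergence of the integrals -/

section OutputDensity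

/-- The mean of the output of the channel with parameter `θ` for the input `x`. -/
def scale (θ : ℝ) (x : ℝ≥0) : ℝ := θ ^ 2 * (x : ℝ) + 1

theorem one_le_scale (θ : ℝ) (x : ℝ≥0) : 1 ≤ scale θ x := by
  unfold scale
  have : 0 ≤ θ ^ 2 * (x : ℝ) := by positivity
  linarith

theorem scale_pos (θ : ℝ) (x : ℝ≥0) : 0 < scale θ x :=
  zero_lt_one.trans_le (one_le_scale θ x)

theorem density_eq (θ : ℝ) (x : ℝ≥0) (y : ℝ) :
    density θ x y = (scale θ x)⁻¹ * Real.exp (-y / scale θ x) := by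
  simp only [density, scale, one_div]

theorem density_pos (θ : ℝ) (x : ℝ≥0) (y : ℝ) : 0 < density θ x y := by
  rw [density_eq]
  have := scale_pos θ x
  positivity

theorem log_density (θ : ℝ) (x : ℝ≥0) (y : ℝ) :
    Real.log (density θ x y) = -Real.log (scale θ x) - y / scale θ x := by
  have := scale_pos θ x
  rw [density_eq, Real.log_mul (by positivity) (Real.exp_pos _).ne', Real.log_inv, Real.log_exp]
  ring

theorem density_le_one (θ : ℝ) (x : ℝ≥0) {y : ℝ} (hy : 0 ≤ y) : density θ x y ≤ 1 := by
  have h := one_le_scale θ x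
  have h0 := scale_pos θ x
  rw [density_eq]
  refine mul_le_one₀ (inv_le_one_of_one_le₀ h) (Real.exp_pos _).le (Real.exp_le_one_iff.2 ?_)
  exact div_nonpos_of_nonpos_of_nonneg (by linarith) h0.le

/-- The mean is at least 1, so the decay rate is at most 1. A rate independent of x lets the bound
be integrated over any input law. -/
theorem le_density (θ : ℝ) (x : ℝ≥0) {y : ℝ} (hy : 0 ≤ y) :
    (scale θ x)⁻¹ * Real.exp (-y) ≤ density θ x y := by
  have h := one_le_scale θ x
  have h0 := scale_pos θ x
  rw [density_eq]
  gcongr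
  rw [le_div_iff₀ h0]
  nlinarith

theorem measurable_scale (θ : ℝ) : Measurable (scale θ) := by
  unfold scale
  fun_prop

theorem continuous_scale (θ : ℝ) : Continuous (scale θ) := by
  unfold scale
  fun_prop

theorem continuous_density_left (θ y : ℝ) : Continuous (fun x => density θ x y) := by
  simp only [density_eq]
  have := continuous_scale θ
  have h0 := fun x => (scale_pos θ x).ne'
  fun_prop (disch := exact h0)

theorem continuous_density_right (θ : ℝ) (x : ℝ≥0) : Continuous (density θ x) := by
  unfold density
  fun_prop

theorem integral_density (θ : ℝ) (x : ℝ≥0) : ∫ y in Set.Ioi (0 : ℝ), density θ x y = 1 := by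
  have h0 := scale_pos θ x
  have h := Real.integral_rpow_mul_exp_neg_mul_Ioi (a := 1) (r := (scale θ x)⁻¹)
    one_pos (by positivity)
  simp only [density_eq, integral_const_mul]
  have e : ∀ t : ℝ, t ^ ((1 : ℝ) - 1) * Real.exp (-((scale θ x)⁻¹ * t))
      = Real.exp (-t / scale θ x) := by
    intro t
    rw [sub_self, Real.rpow_zero, one_mul]
    congr 1
    field_simp
  simp only [e] at h
  rw [h]
  simp [h0.ne']

theorem integral_density_mul_id (θ : ℝ) (x : ℝ≥0) :
    ∫ y in Set.Ioi (0 : ℝ), density θ x y * y = scale θ x := by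
  have h0 := scale_pos θ x
  have h := Real.integral_rpow_mul_exp_neg_mul_Ioi (a := 2) (r := (scale θ x)⁻¹)
    two_pos (by positivity)
  have e : ∀ t : ℝ, t ^ ((2 : ℝ) - 1) * Real.exp (-((scale θ x)⁻¹ * t))
      = scale θ x * (density θ x t * t) := by
    intro t
    have : (2 : ℝ) - 1 = 1 := by norm_num
    rw [this, Real.rpow_one, density_eq]
    have : -((scale θ x)⁻¹ * t) = -t / scale θ x := by field_simp
    rw [this]
    field_simp
  simp only [e, integral_const_mul, Real.Gamma_two] at h
  simp only [one_div, inv_inv, Real.rpow_ofNat, mul_one] at h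
  exact mul_left_cancel₀ h0.ne' (h.trans (pow_two _))

theorem integrable_density (θ : ℝ) (x : ℝ≥0) : IntegrableOn (density θ x) (Set.Ioi 0) :=
  Integrable.of_integral_ne_zero (by rw [integral_density]; exact one_ne_zero)

theorem integrable_density_mul_id (θ : ℝ) (x : ℝ≥0) :
    IntegrableOn (fun y => density θ x y * y) (Set.Ioi 0) :=
  Integrable.of_integral_ne_zero (by rw [integral_density_mul_id]; exact (scale_pos θ x).ne')

/-- `f` is measurable and grows at most linearly on the positive half-line. -/
def LinearGrowth (f : ℝ → ℝ) (C : ℝ) : Prop :=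
  Measurable f ∧ ∀ y, 0 < y → |f y| ≤ C + y

theorem LinearGrowth.integrable_density_mul {f : ℝ → ℝ} {C : ℝ} (hf : LinearGrowth f C)
    (θ : ℝ) (x : ℝ≥0) : IntegrableOn (fun y => density θ x y * f y) (Set.Ioi 0) := by
  refine Integrable.mono' (((integrable_density θ x).mul_const C).add
    (integrable_density_mul_id θ x)) ?_ ?_
  · exact ((continuous_density_right θ x).measurable.mul hf.1).aestronglyMeasurable
  · refine (ae_restrict_iff' measurableSet_Ioi).2 (.of_forall fun y hy => ?_)
    rw [Real.norm_eq_abs, abs_mul, abs_of_pos (density_pos θ x y), Pi.add_apply, ← mul_add]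
    exact mul_le_mul_of_nonneg_left (hf.2 y hy) (density_pos θ x y).le

theorem LinearGrowth.integral_abs_le {f : ℝ → ℝ} {C : ℝ} (hf : LinearGrowth f C)
    (θ : ℝ) (x : ℝ≥0) : ∫ y in Set.Ioi (0 : ℝ), ‖density θ x y * f y‖ ≤ C + scale θ x := by
  have : C + scale θ x = ∫ y in Set.Ioi (0 : ℝ), (density θ x y * C + density θ x y * y) := by
    rw [integral_add ((integrable_density θ x).mul_const C) (integrable_density_mul_id θ x),
      integral_mul_const, integral_density, integral_density_mul_id, one_mul]
  rw [this]
  refine setIntegral_mono_on (hf.integrable_density_mul θ x).norm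
    (((integrable_density θ x).mul_const C).add (integrable_density_mul_id θ x))
    measurableSet_Ioi fun y hy => ?_
  rw [Real.norm_eq_abs, abs_mul, abs_of_pos (density_pos θ x y), ← mul_add]
  exact mul_le_mul_of_nonneg_left (hf.2 y hy) (density_pos θ x y).le

/-- The input law `μ` has a finite mean. -/
def HasMean (μ : ProbabilityMeasure ℝ≥0) : Prop :=
  Integrable (fun x : ℝ≥0 => (x : ℝ)) (μ : Measure ℝ≥0)

variable {μ μ₁ : ProbabilityMeasure ℝ≥0}

theorem HasMean.integrable_scale (h : HasMean μ) (θ : ℝ) :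
    Integrable (scale θ) (μ : Measure ℝ≥0) :=
  (Integrable.const_mul h _).add (integrable_const 1)

theorem HasMean.integrable_log_scale (h : HasMean μ) (θ : ℝ) :
    Integrable (fun x => Real.log (scale θ x)) (μ : Measure ℝ≥0) := by
  refine (h.integrable_scale θ).mono' (measurable_scale θ).log.aestronglyMeasurable
    (.of_forall fun x => ?_)
  rw [Real.norm_eq_abs, abs_of_nonneg (Real.log_nonneg (one_le_scale θ x))]
  exact (Real.log_le_sub_one_of_pos (scale_pos θ x)).trans (by linarith)

/-- The inner integral of the absolute value is at most C plus the output mean, which is affine in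
x. This justifies every use of Fubini for the cross terms. -/
theorem LinearGrowth.integrable_prod {f : ℝ → ℝ} {C : ℝ} (hf : LinearGrowth f C)
    (h : HasMean μ) (θ : ℝ) :
    Integrable (fun p : ℝ≥0 × ℝ => density θ p.1 p.2 * f p.2)
      ((μ : Measure ℝ≥0).prod (volume.restrict (Set.Ioi 0))) := by
  have hm : Measurable (fun p : ℝ≥0 × ℝ => density θ p.1 p.2 * f p.2) :=
    (measurable_density θ).mul (hf.1.comp measurable_snd)
  rw [integrable_prod_iff hm.aestronglyMeasurable]
  refine ⟨.of_forall fun x => hf.integrable_density_mul θ x, ?_⟩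
  refine ((integrable_const C).add (h.integrable_scale θ)).mono'
    hm.norm.stronglyMeasurable.integral_prod_right'.aestronglyMeasurable (.of_forall fun x => ?_)
  rw [Real.norm_eq_abs, abs_of_nonneg (integral_nonneg fun _ => norm_nonneg _)]
  exact hf.integral_abs_le θ x

theorem LinearGrowth.integrable_integral {f : ℝ → ℝ} {C : ℝ} (hf : LinearGrowth f C)
    (h : HasMean μ) (θ : ℝ) :
    Integrable (fun x => ∫ y in Set.Ioi (0 : ℝ), density θ x y * f y) (μ : Measure ℝ≥0) :=
  (hf.integrable_prod h θ).integral_prod_left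

theorem LinearGrowth.integrable_outputDensity_mul {f : ℝ → ℝ} {C : ℝ} (hf : LinearGrowth f C)
    (h : HasMean μ) (θ : ℝ) :
    IntegrableOn (fun y => outputDensity θ μ y * f y) (Set.Ioi 0) := by
  have := (hf.integrable_prod h θ).integral_prod_right
  simpa only [integral_mul_const, outputDensity] using! this

theorem LinearGrowth.integral_outputDensity_mul {f : ℝ → ℝ} {C : ℝ} (hf : LinearGrowth f C)
    (h : HasMean μ) (θ : ℝ) :
    ∫ y in Set.Ioi (0 : ℝ), outputDensity θ μ y * f y
      = ∫ x, (∫ y in Set.Ioi (0 : ℝ), density θ x y * f y) ∂(μ : Measure ℝ≥0) := by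
  simp only [outputDensity, ← integral_mul_const]
  exact (integral_integral_swap (f := fun x y => density θ x y * f y)
    (hf.integrable_prod h θ)).symm

theorem linearGrowth_one : LinearGrowth (fun _ => 1) 1 :=
  ⟨measurable_const, fun y hy => by rw [abs_one]; linarith⟩

theorem linearGrowth_id : LinearGrowth (fun y => y) 0 :=
  ⟨measurable_id, fun y hy => by rw [abs_of_pos hy]; linarith⟩

theorem integrable_density_left (θ : ℝ) (μ : ProbabilityMeasure ℝ≥0) {y : ℝ} (hy : 0 ≤ y) :
    Integrable (fun x => density θ x y) (μ : Measure ℝ≥0) :=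
  (integrable_const (1 : ℝ)).mono' (continuous_density_left θ y).aestronglyMeasurable
    (.of_forall fun x => by
      rw [Real.norm_eq_abs, abs_of_pos (density_pos θ x y)]; exact density_le_one θ x hy)

theorem outputDensity_le_one (θ : ℝ) (μ : ProbabilityMeasure ℝ≥0) {y : ℝ} (hy : 0 ≤ y) :
    outputDensity θ μ y ≤ 1 := by
  refine (integral_mono (integrable_density_left θ μ hy) (integrable_const 1)
    fun x => density_le_one θ x hy).trans (by simp)

/-- The constant `c` in the lower bound `c e^{-y}` for the density of the output law. -/
def tailConst (θ : ℝ) (μ : ProbabilityMeasure ℝ≥0) : ℝ := ∫ x, (scale θ x)⁻¹ ∂(μ : Measure ℝ≥0)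

theorem integrable_inv_scale (θ : ℝ) (μ : ProbabilityMeasure ℝ≥0) :
    Integrable (fun x => (scale θ x)⁻¹) (μ : Measure ℝ≥0) :=
  (integrable_const (1 : ℝ)).mono' (measurable_scale θ).inv.aestronglyMeasurable
    (.of_forall fun x => by
      have := scale_pos θ x
      rw [Real.norm_eq_abs, abs_of_pos (by positivity)]
      exact inv_le_one_of_one_le₀ (one_le_scale θ x))

theorem tailConst_pos (θ : ℝ) (μ : ProbabilityMeasure ℝ≥0) : 0 < tailConst θ μ := by
  have hp : ∀ x, 0 < (scale θ x)⁻¹ := fun x => inv_pos.2 (scale_pos θ x)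
  refine (integral_pos_iff_support_of_nonneg (fun x => (hp x).le) (integrable_inv_scale θ μ)).2 ?_
  have : Function.support (fun x => (scale θ x)⁻¹) = Set.univ :=
    Set.eq_univ_of_forall fun x => (hp x).ne'
  rw [this]
  simp

theorem le_outputDensity (θ : ℝ) (μ : ProbabilityMeasure ℝ≥0) {y : ℝ} (hy : 0 ≤ y) :
    tailConst θ μ * Real.exp (-y) ≤ outputDensity θ μ y := by
  rw [tailConst, ← integral_mul_const]
  exact integral_mono ((integrable_inv_scale θ μ).mul_const _) (integrable_density_left θ μ hy)
    fun x => le_density θ x hy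

theorem outputDensity_pos (θ : ℝ) (μ : ProbabilityMeasure ℝ≥0) {y : ℝ} (hy : 0 ≤ y) :
    0 < outputDensity θ μ y :=
  (mul_pos (tailConst_pos θ μ) (Real.exp_pos _)).trans_le (le_outputDensity θ μ hy)

theorem outputDensity_nonneg (θ : ℝ) (μ : ProbabilityMeasure ℝ≥0) (y : ℝ) :
    0 ≤ outputDensity θ μ y :=
  integral_nonneg fun x => density_nonneg θ x y

theorem measurable_outputDensity (θ : ℝ) (μ : ProbabilityMeasure ℝ≥0) :
    Measurable (outputDensity θ μ) :=
  (measurable_density θ).stronglyMeasurable.integral_prod_left'.measurable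

theorem abs_log_le_of_bounds {c r y : ℝ} (hc : 0 < c) (h1 : c * Real.exp (-y) ≤ r) (h2 : r ≤ 1) :
    |Real.log r| ≤ -Real.log c + y := by
  have hr : 0 < r := (mul_pos hc (Real.exp_pos _)).trans_le h1
  have h := Real.log_le_log (mul_pos hc (Real.exp_pos _)) h1
  rw [Real.log_mul hc.ne' (Real.exp_pos _).ne', Real.log_exp] at h
  rw [abs_of_nonpos (Real.log_nonpos hr.le h2)]
  linarith

/-- No moment assumption on μ is needed: the exponential lower bound holds for every input law. -/
theorem linearGrowth_log_outputDensity (θ : ℝ) (μ : ProbabilityMeasure ℝ≥0) :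
    LinearGrowth (fun y => Real.log (outputDensity θ μ y)) (-Real.log (tailConst θ μ)) :=
  ⟨(measurable_outputDensity θ μ).log, fun _ hy => abs_log_le_of_bounds (tailConst_pos θ μ)
    (le_outputDensity θ μ hy.le) (outputDensity_le_one θ μ hy.le)⟩

theorem HasMean.integrable_outputDensity (h : HasMean μ) (θ : ℝ) :
    IntegrableOn (outputDensity θ μ) (Set.Ioi 0) := by
  simpa using! linearGrowth_one.integrable_outputDensity_mul h θ

theorem HasMean.integral_outputDensity (h : HasMean μ) (θ : ℝ) :
    ∫ y in Set.Ioi (0 : ℝ), outputDensity θ μ y = 1 := by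
  have := linearGrowth_one.integral_outputDensity_mul h θ
  simpa [integral_density] using this

theorem HasMean.integrable_outputDensity_mul_id (h : HasMean μ) (θ : ℝ) :
    IntegrableOn (fun y => outputDensity θ μ y * y) (Set.Ioi 0) :=
  linearGrowth_id.integrable_outputDensity_mul h θ

theorem HasMean.integral_outputDensity_mul_id (h : HasMean μ) (θ : ℝ) :
    ∫ y in Set.Ioi (0 : ℝ), outputDensity θ μ y * y = ∫ x, scale θ x ∂(μ : Measure ℝ≥0) := by
  have := linearGrowth_id.integral_outputDensity_mul h θ
  simpa [integral_density_mul_id] using this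

/-- The integral of `w(y|x) log (w ∘ μ₁)(y)` over `y`. -/
def crossAt (θ : ℝ) (μ₁ : ProbabilityMeasure ℝ≥0) (x : ℝ≥0) : ℝ :=
  ∫ y in Set.Ioi (0 : ℝ), density θ x y * Real.log (outputDensity θ μ₁ y)

/-- The integral of `(w ∘ μ)(y) log (w ∘ μ₁)(y)` over `y` (the negative cross entropy). -/
def cross (θ : ℝ) (μ μ₁ : ProbabilityMeasure ℝ≥0) : ℝ :=
  ∫ y in Set.Ioi (0 : ℝ), outputDensity θ μ y * Real.log (outputDensity θ μ₁ y)

theorem HasMean.integrable_crossAt (h : HasMean μ) (θ : ℝ) (μ₁ : ProbabilityMeasure ℝ≥0) :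
    Integrable (crossAt θ μ₁) (μ : Measure ℝ≥0) :=
  (linearGrowth_log_outputDensity θ μ₁).integrable_integral h θ

theorem HasMean.integrable_cross (h : HasMean μ) (θ : ℝ) (μ₁ : ProbabilityMeasure ℝ≥0) :
    IntegrableOn (fun y => outputDensity θ μ y * Real.log (outputDensity θ μ₁ y)) (Set.Ioi 0) :=
  (linearGrowth_log_outputDensity θ μ₁).integrable_outputDensity_mul h θ

theorem HasMean.integral_crossAt (h : HasMean μ) (θ : ℝ) (μ₁ : ProbabilityMeasure ℝ≥0) :
    ∫ x, crossAt θ μ₁ x ∂(μ : Measure ℝ≥0) = cross θ μ μ₁ :=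
  ((linearGrowth_log_outputDensity θ μ₁).integral_outputDensity_mul h θ).symm

theorem mainIntegrand_eq (θ : ℝ) (μ₁ : ProbabilityMeasure ℝ≥0) (x : ℝ≥0) {y : ℝ} (hy : 0 ≤ y) :
    mainIntegrand θ μ₁ x y = density θ x y * (-Real.log (scale θ x))
      - (density θ x y * y) * (scale θ x)⁻¹
      - density θ x y * Real.log (outputDensity θ μ₁ y) := by
  rw [mainIntegrand, Real.log_div (density_pos θ x y).ne' (outputDensity_pos θ μ₁ hy).ne',
    log_density]
  ring

theorem density_one_zero (z : ℝ) : density 1 0 z = Real.exp (-z) := by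
  simp [density]

theorem wardenIntegrand_eq (μ₁ : ProbabilityMeasure ℝ≥0) (x : ℝ≥0) {z : ℝ} (hz : 0 ≤ z) :
    wardenIntegrand μ₁ x z = density 1 x z * Real.log (outputDensity 1 μ₁ z)
      + density 1 x z * z := by
  rw [wardenIntegrand, Real.log_div (outputDensity_pos 1 μ₁ hz).ne' (density_pos 1 0 z).ne',
    density_one_zero, Real.log_exp]
  ring

theorem integrable_mainIntegrand (θ : ℝ) (μ₁ : ProbabilityMeasure ℝ≥0) (x : ℝ≥0) :
    IntegrableOn (mainIntegrand θ μ₁ x) (Set.Ioi 0) :=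
  IntegrableOn.congr_fun ((((integrable_density θ x).mul_const _).sub
    ((integrable_density_mul_id θ x).mul_const _)).sub
    ((linearGrowth_log_outputDensity θ μ₁).integrable_density_mul θ x))
    (fun _ hy => (mainIntegrand_eq θ μ₁ x (le_of_lt hy)).symm) measurableSet_Ioi

/-- An exponential law of mean s has differential entropy 1 + log s. -/
theorem integral_mainIntegrand (θ : ℝ) (μ₁ : ProbabilityMeasure ℝ≥0) (x : ℝ≥0) :
    ∫ y in Set.Ioi (0 : ℝ), mainIntegrand θ μ₁ x y
      = -Real.log (scale θ x) - 1 - crossAt θ μ₁ x := by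
  rw [setIntegral_congr_fun measurableSet_Ioi
    (fun _ hy => mainIntegrand_eq θ μ₁ x (le_of_lt hy)), integral_sub
      (((integrable_density θ x).mul_const _).sub'
        ((integrable_density_mul_id θ x).mul_const _))
      ((linearGrowth_log_outputDensity θ μ₁).integrable_density_mul θ x),
    integral_sub ((integrable_density θ x).mul_const _)
      ((integrable_density_mul_id θ x).mul_const _), integral_mul_const, integral_mul_const,
    integral_density, integral_density_mul_id, mul_inv_cancel₀ (scale_pos θ x).ne', one_mul,
    crossAt]

theorem integrable_wardenIntegrand (μ₁ : ProbabilityMeasure ℝ≥0) (x : ℝ≥0) :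
    IntegrableOn (wardenIntegrand μ₁ x) (Set.Ioi 0) :=
  IntegrableOn.congr_fun (((linearGrowth_log_outputDensity 1 μ₁).integrable_density_mul 1 x).add
    (integrable_density_mul_id 1 x))
    (fun _ hy => (wardenIntegrand_eq μ₁ x (le_of_lt hy)).symm) measurableSet_Ioi

theorem integral_wardenIntegrand (μ₁ : ProbabilityMeasure ℝ≥0) (x : ℝ≥0) :
    ∫ z in Set.Ioi (0 : ℝ), wardenIntegrand μ₁ x z = crossAt 1 μ₁ x + scale 1 x := by
  rw [setIntegral_congr_fun measurableSet_Ioi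
    (fun _ hy => wardenIntegrand_eq μ₁ x (le_of_lt hy)), integral_add
      ((linearGrowth_log_outputDensity 1 μ₁).integrable_density_mul 1 x)
      (integrable_density_mul_id 1 x), integral_density_mul_id, crossAt]

theorem kktFun_eq (θ ν g : ℝ) (μ₁ : ProbabilityMeasure ℝ≥0) (x : ℝ≥0) :
    kktFun θ ν g μ₁ x = (-Real.log (scale θ x) - 1 - crossAt θ μ₁ x)
      - g * (crossAt 1 μ₁ x + scale 1 x - ν) := by
  rw [kktFun, integral_mainIntegrand, integral_wardenIntegrand]

theorem HasMean.integrable_kktFun (h : HasMean μ) (θ ν g : ℝ) (μ₁ : ProbabilityMeasure ℝ≥0) :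
    Integrable (kktFun θ ν g μ₁) (μ : Measure ℝ≥0) := by
  simp only [funext (kktFun_eq θ ν g μ₁)]
  exact (((h.integrable_log_scale θ).neg.sub (integrable_const 1)).sub
    (h.integrable_crossAt θ μ₁)).sub
    ((((h.integrable_crossAt 1 μ₁).add (h.integrable_scale 1)).sub
      (integrable_const ν)).const_mul g)

/-- The law μ₁ enters only through the two cross terms, so Gibbs' inequality can compare different
choices of μ₁ for the same μ. -/
theorem HasMean.integral_kktFun (h : HasMean μ) (θ ν g : ℝ) (μ₁ : ProbabilityMeasure ℝ≥0) :
    ∫ x, kktFun θ ν g μ₁ x ∂(μ : Measure ℝ≥0)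
      = (-(∫ x, Real.log (scale θ x) ∂(μ : Measure ℝ≥0)) - 1 - cross θ μ μ₁)
        - g * (cross 1 μ μ₁ + (∫ x, scale 1 x ∂(μ : Measure ℝ≥0)) - ν) := by
  simp only [kktFun_eq]
  rw [integral_sub (((h.integrable_log_scale θ).fun_neg.sub' (integrable_const 1)).sub'
    (h.integrable_crossAt θ μ₁)) ((((h.integrable_crossAt 1 μ₁).fun_add (h.integrable_scale 1)).sub'
      (integrable_const ν)).const_mul g), integral_sub
      ((h.integrable_log_scale θ).fun_neg.sub' (integrable_const 1)) (h.integrable_crossAt θ μ₁),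
    integral_sub (h.integrable_log_scale θ).fun_neg (integrable_const 1), integral_const_mul,
    integral_sub ((h.integrable_crossAt 1 μ₁).fun_add (h.integrable_scale 1)) (integrable_const ν),
    integral_add (h.integrable_crossAt 1 μ₁) (h.integrable_scale 1), integral_neg,
    h.integral_crossAt, h.integral_crossAt]
  simp

/-- The function `crossAt` is continuous in the input. -/
theorem continuous_crossAt (θ : ℝ) (μ₁ : ProbabilityMeasure ℝ≥0) :
    Continuous (crossAt θ μ₁) := by
  rw [continuous_iff_continuousAt]
  intro x₀
  have hf := linearGrowth_log_outputDensity θ μ₁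
  set C := -Real.log (tailConst θ μ₁)
  set x₁ : ℝ≥0 := x₀ + 1
  have hev : ∀ᶠ x in 𝓝 x₀, x ≤ x₁ := by
    filter_upwards [Iio_mem_nhds (show x₀ < x₁ from lt_add_one x₀)] with x hx using le_of_lt hx
  -- Up to a constant, the density with the largest mean dominates all those of smaller mean, which
  -- gives a local majorant near x₀.
  have hdom : ∀ x ≤ x₁, ∀ y, 0 < y → density θ x y ≤ scale θ x₁ * density θ x₁ y := by
    intro x hx y hy
    have h1 := one_le_scale θ x
    have h2 := scale_pos θ x₁
    have hle : scale θ x ≤ scale θ x₁ := by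
      unfold scale
      gcongr
    rw [density_eq, density_eq, ← mul_assoc, mul_inv_cancel₀ h2.ne']
    refine mul_le_mul (inv_le_one_of_one_le₀ h1) (Real.exp_le_exp.2 ?_) (Real.exp_pos _).le
      zero_le_one
    rw [neg_div, neg_div, neg_le_neg_iff]
    gcongr
  refine tendsto_integral_filter_of_dominated_convergence
    (fun y => scale θ x₁ * (density θ x₁ y * C + density θ x₁ y * y)) ?_ ?_ ?_ ?_
  · exact .of_forall fun x =>
      ((continuous_density_right θ x).measurable.mul hf.1).aestronglyMeasurable
  · filter_upwards [hev] with x hx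
    refine (ae_restrict_iff' measurableSet_Ioi).2 (.of_forall fun y hy => ?_)
    rw [Real.norm_eq_abs, abs_mul, abs_of_pos (density_pos θ x y), ← mul_add, ← mul_assoc]
    exact mul_le_mul (hdom x hx y hy) (hf.2 y hy) (abs_nonneg _)
      (mul_nonneg (scale_pos θ x₁).le (density_nonneg θ x₁ y))
  · exact (((integrable_density θ x₁).mul_const C).add
      (integrable_density_mul_id θ x₁)).const_mul _
  · exact .of_forall fun y => ((continuous_density_left θ y).tendsto x₀).mul_const _

theorem continuous_kktFun (θ ν g : ℝ) (μ₁ : ProbabilityMeasure ℝ≥0) :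
    Continuous (kktFun θ ν g μ₁) := by
  simp only [funext (kktFun_eq θ ν g μ₁)]
  have h1 := continuous_crossAt θ μ₁
  have h2 := continuous_crossAt 1 μ₁
  have h3 := continuous_scale 1
  have h4 : Continuous fun x => Real.log (scale θ x) :=
    (continuous_scale θ).log fun x => (scale_pos θ x).ne'
  fun_prop

end OutputDensity

/-! ### Relative entropy and mutual information as integrals of densities -/

section RelativeEntropy

variable {μ μ₁ : ProbabilityMeasure ℝ≥0}

section KL

variable {α : Type*} [MeasurableSpace α] {ρ P Q : Measure α} {f g : α → ℝ}

/-- Since g is positive almost everywhere, P has density f / g with respect to Q. -/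
theorem rnDeriv_of_withDensity [SigmaFinite Q] (hf : Measurable f) (hg : Measurable g)
    (hg0 : ∀ᵐ a ∂ρ, 0 < g a)
    (hP : P = ρ.withDensity fun a => ENNReal.ofReal (f a))
    (hQ : Q = ρ.withDensity fun a => ENNReal.ofReal (g a)) :
    P ≪ Q ∧ P.rnDeriv Q =ᵐ[Q] fun a => ENNReal.ofReal (f a / g a) := by
  have hPQ : P = Q.withDensity fun a => ENNReal.ofReal (f a / g a) := by
    rw [hQ, ← withDensity_mul _ hg.ennreal_ofReal
      (show Measurable fun a => ENNReal.ofReal (f a / g a) from (hf.div hg).ennreal_ofReal), hP]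
    refine withDensity_congr_ae ?_
    filter_upwards [hg0] with a ha
    rw [Pi.mul_apply, ← ENNReal.ofReal_mul ha.le, mul_div_cancel₀ _ ha.ne']
  refine ⟨hPQ ▸ withDensity_absolutelyContinuous _ _, ?_⟩
  have := Measure.rnDeriv_withDensity Q (hf.div hg).ennreal_ofReal
  rw [hPQ]
  exact this

theorem llr_of_withDensity [SigmaFinite Q] (hf : Measurable f) (hg : Measurable g)
    (hf0 : ∀ᵐ a ∂ρ, 0 ≤ f a) (hg0 : ∀ᵐ a ∂ρ, 0 < g a)
    (hP : P = ρ.withDensity fun a => ENNReal.ofReal (f a))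
    (hQ : Q = ρ.withDensity fun a => ENNReal.ofReal (g a)) :
    llr P Q =ᵐ[P] fun a => Real.log (f a / g a) := by
  obtain ⟨hac, hr⟩ := rnDeriv_of_withDensity hf hg hg0 hP hQ
  have hPρ : P ≪ ρ := hP ▸ withDensity_absolutelyContinuous _ _
  filter_upwards [hac.ae_le hr, hPρ.ae_le hf0, hPρ.ae_le hg0] with a h1 h2 h3
  rw [llr, h1, ENNReal.toReal_ofReal (div_nonneg h2 h3.le)]

theorem integrable_llr_iff [SigmaFinite Q] (hf : Measurable f) (hg : Measurable g)
    (hf0 : ∀ᵐ a ∂ρ, 0 ≤ f a) (hg0 : ∀ᵐ a ∂ρ, 0 < g a)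
    (hP : P = ρ.withDensity fun a => ENNReal.ofReal (f a))
    (hQ : Q = ρ.withDensity fun a => ENNReal.ofReal (g a)) :
    Integrable (llr P Q) P ↔ Integrable (fun a => f a * Real.log (f a / g a)) ρ := by
  rw [integrable_congr (llr_of_withDensity hf hg hf0 hg0 hP hQ), hP,
    integrable_withDensity_iff_integrable_smul' hf.ennreal_ofReal
      (.of_forall fun _ => ENNReal.ofReal_lt_top)]
  refine integrable_congr ?_
  filter_upwards [hf0] with a ha
  rw [ENNReal.toReal_ofReal ha, smul_eq_mul]

theorem klDiv_lt_top_iff_of_withDensity [SigmaFinite Q] (hf : Measurable f) (hg : Measurable g)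
    (hf0 : ∀ᵐ a ∂ρ, 0 ≤ f a) (hg0 : ∀ᵐ a ∂ρ, 0 < g a)
    (hP : P = ρ.withDensity fun a => ENNReal.ofReal (f a))
    (hQ : Q = ρ.withDensity fun a => ENNReal.ofReal (g a)) :
    klDiv P Q < ∞ ↔ Integrable (fun a => f a * Real.log (f a / g a)) ρ := by
  rw [lt_top_iff_ne_top, klDiv_ne_top_iff, integrable_llr_iff hf hg hf0 hg0 hP hQ]
  exact and_iff_right (rnDeriv_of_withDensity hf hg hg0 hP hQ).1

theorem toReal_klDiv_of_withDensity [IsProbabilityMeasure P] [IsProbabilityMeasure Q]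
    (hf : Measurable f) (hg : Measurable g)
    (hf0 : ∀ᵐ a ∂ρ, 0 ≤ f a) (hg0 : ∀ᵐ a ∂ρ, 0 < g a)
    (hP : P = ρ.withDensity fun a => ENNReal.ofReal (f a))
    (hQ : Q = ρ.withDensity fun a => ENNReal.ofReal (g a)) :
    (klDiv P Q).toReal = ∫ a, f a * Real.log (f a / g a) ∂ρ := by
  rw [toReal_klDiv_of_measure_eq (rnDeriv_of_withDensity hf hg hg0 hP hQ).1 (by simp),
    integral_congr_ae (llr_of_withDensity hf hg hf0 hg0 hP hQ), hP,
    integral_withDensity_eq_integral_toReal_smul hf.ennreal_ofReal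
      (.of_forall fun _ => ENNReal.ofReal_lt_top)]
  refine integral_congr_ae ?_
  filter_upwards [hf0] with a ha
  rw [ENNReal.toReal_ofReal ha, smul_eq_mul]

end KL

theorem channel_apply (θ : ℝ) (x : ℝ≥0) : channel θ x =
    (volume.restrict (Set.Ioi (0 : ℝ))).withDensity (fun y => ENNReal.ofReal (density θ x y)) :=
  rfl

theorem outputLaw_eq (θ : ℝ) (μ : ProbabilityMeasure ℝ≥0) : outputLaw θ μ =
    (volume.restrict (Set.Ioi (0 : ℝ))).withDensity
      (fun y => ENNReal.ofReal (outputDensity θ μ y)) := by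
  ext s hs
  rw [outputLaw, Measure.bind_apply hs (channel θ).measurable.aemeasurable]
  simp only [channel_apply]
  rw [withDensity_apply _ hs]
  simp only [withDensity_apply _ hs]
  rw [lintegral_lintegral_swap (measurable_density θ).ennreal_ofReal.aemeasurable,
    Measure.restrict_restrict hs]
  refine setLIntegral_congr_fun (hs.inter measurableSet_Ioi) fun y hy => ?_
  exact (ofReal_integral_eq_lintegral_ofReal (integrable_density_left θ μ (le_of_lt hy.2))
    (.of_forall fun x => density_nonneg θ x y)).symm

theorem compProd_channel_eq (θ : ℝ) (μ : ProbabilityMeasure ℝ≥0) :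
    (μ : Measure ℝ≥0).compProd (channel θ) =
      ((μ : Measure ℝ≥0).prod (volume.restrict (Set.Ioi (0 : ℝ)))).withDensity
        (fun p => ENNReal.ofReal (density θ p.1 p.2)) := by
  ext s hs
  rw [Measure.compProd_apply hs, withDensity_apply _ hs, ← lintegral_indicator hs,
    lintegral_prod _ ((measurable_density θ).ennreal_ofReal.indicator hs).aemeasurable]
  refine lintegral_congr fun x => ?_
  rw [channel_apply, withDensity_apply _ (measurable_prodMk_left hs),
    ← lintegral_indicator (measurable_prodMk_left hs)]
  rfl

theorem prod_outputLaw_eq (θ : ℝ) (μ : ProbabilityMeasure ℝ≥0) :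
    (μ : Measure ℝ≥0).prod (outputLaw θ μ) =
      ((μ : Measure ℝ≥0).prod (volume.restrict (Set.Ioi (0 : ℝ)))).withDensity
        (fun p => ENNReal.ofReal (outputDensity θ μ p.2)) := by
  rw [outputLaw_eq, prod_withDensity_right (measurable_outputDensity θ μ).ennreal_ofReal]

instance isProbabilityMeasure_outputLaw (θ : ℝ) (μ : ProbabilityMeasure ℝ≥0) :
    IsProbabilityMeasure (outputLaw θ μ) := by
  unfold outputLaw
  infer_instance

theorem ae_prod_pos (μ : ProbabilityMeasure ℝ≥0) :
    ∀ᵐ p ∂(μ : Measure ℝ≥0).prod (volume.restrict (Set.Ioi (0 : ℝ))), 0 < p.2 :=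
  Measure.quasiMeasurePreserving_snd.ae
    ((ae_restrict_iff' measurableSet_Ioi).2 (.of_forall fun _ hy => hy))

theorem ae_Ioi_pos : ∀ᵐ y ∂(volume.restrict (Set.Ioi (0 : ℝ))), 0 < y :=
  (ae_restrict_iff' measurableSet_Ioi).2 (.of_forall fun _ hy => hy)

theorem wardenDiv_lt_top_iff (μ : ProbabilityMeasure ℝ≥0) : wardenDiv μ < ∞ ↔
    IntegrableOn (fun z => outputDensity 1 μ z *
      Real.log (outputDensity 1 μ z / density 1 0 z)) (Set.Ioi 0) :=
  klDiv_lt_top_iff_of_withDensity (measurable_outputDensity 1 μ)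
    (continuous_density_right 1 0).measurable (.of_forall (outputDensity_nonneg 1 μ))
    (.of_forall (density_pos 1 0)) (outputLaw_eq 1 μ) (channel_apply 1 0)

theorem wardenDiv_integrand_eq (μ : ProbabilityMeasure ℝ≥0) {z : ℝ} (hz : 0 ≤ z) :
    outputDensity 1 μ z * Real.log (outputDensity 1 μ z / density 1 0 z)
      = outputDensity 1 μ z * Real.log (outputDensity 1 μ z) + outputDensity 1 μ z * z := by
  rw [Real.log_div (outputDensity_pos 1 μ hz).ne' (density_pos 1 0 z).ne', density_one_zero,
    Real.log_exp]
  ring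

/-- Gibbs' inequality in pointwise form. -/
theorem mul_log_sub_log_le {p q : ℝ} (hp : 0 < p) (hq : 0 < q) :
    p * Real.log q - p * Real.log p ≤ q - p := by
  have h := Real.log_le_sub_one_of_pos (div_pos hq hp)
  rw [Real.log_div hq.ne' hp.ne'] at h
  have := mul_le_mul_of_nonneg_left h hp.le
  have e : p * (q / p - 1) = q - p := by field_simp
  linarith

/-- By Tonelli the output mean is the input mean plus 1, so finiteness passes back from output to
input. -/
theorem hasMean_of_integrable_mul_id
    (h : IntegrableOn (fun z => outputDensity 1 μ z * z) (Set.Ioi 0)) : HasMean μ := by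
  have hm : Measurable (fun p : ℝ≥0 × ℝ => density 1 p.1 p.2 * p.2) :=
    (measurable_density 1).mul measurable_snd
  have hp : Integrable (fun p : ℝ≥0 × ℝ => density 1 p.1 p.2 * p.2)
      ((μ : Measure ℝ≥0).prod (volume.restrict (Set.Ioi 0))) := by
    rw [integrable_prod_iff' hm.aestronglyMeasurable]
    constructor
    · filter_upwards [ae_Ioi_pos] with y hy
      exact (integrable_density_left 1 μ (le_of_lt hy)).mul_const y
    · refine h.congr ?_
      filter_upwards [ae_Ioi_pos] with y hy
      rw [outputDensity, ← integral_mul_const]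
      exact integral_congr_ae (.of_forall fun x => by
        simp [abs_of_pos (density_pos 1 x y), abs_of_pos hy])
  have hs := hp.integral_prod_left
  simp only [integral_density_mul_id, scale] at hs
  have := hs.sub' (integrable_const 1)
  simpa [HasMean] using! this

/-- The term ∫ f z in the divergence cannot be cancelled by ∫ f log f, as comparison with a slower
exponential shows. The converse uses the linear growth of log f. -/
theorem mem_inputLaws_iff (μ : ProbabilityMeasure ℝ≥0) : μ ∈ inputLaws ↔ HasMean μ := by
  change wardenDiv μ < ∞ ↔ _
  rw [wardenDiv_lt_top_iff]
  constructor
  · intro h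
    refine hasMean_of_integrable_mul_id ?_
    -- Gibbs against e^{-z/2} costs only half of the linear term: z f ≤ 2 (f log f + z f +
    -- e^{-z/2}).
    have he : IntegrableOn (fun z : ℝ => Real.exp (-(1 / 2) * z)) (Set.Ioi 0) :=
      integrableOn_exp_mul_Ioi (by norm_num) 0
    refine Integrable.mono' ((h.add he).const_mul 2)
      ((measurable_outputDensity 1 μ).mul measurable_id).aestronglyMeasurable ?_
    filter_upwards [ae_Ioi_pos] with z hz
    have hp := outputDensity_pos 1 μ hz.le
    have h1 := mul_log_sub_log_le hp (Real.exp_pos (-(1 / 2) * z))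
    rw [Real.log_exp] at h1
    rw [Real.norm_eq_abs, abs_of_pos (mul_pos hp hz), Pi.add_apply,
      wardenDiv_integrand_eq μ hz.le]
    linarith
  · intro h
    exact ((h.integrable_cross 1 μ).add (h.integrable_outputDensity_mul_id 1)).congr_fun_ae
      (ae_Ioi_pos.mono fun z hz => (wardenDiv_integrand_eq μ hz.le).symm)

theorem HasMean.toReal_wardenDiv (h : HasMean μ) : (wardenDiv μ).toReal
    = cross 1 μ μ + ∫ x, scale 1 x ∂(μ : Measure ℝ≥0) := by
  rw [wardenDiv, toReal_klDiv_of_withDensity (measurable_outputDensity 1 μ)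
    (continuous_density_right 1 0).measurable (.of_forall (outputDensity_nonneg 1 μ))
    (.of_forall (density_pos 1 0)) (outputLaw_eq 1 μ) (channel_apply 1 0),
    setIntegral_congr_fun measurableSet_Ioi
      (fun z hz => wardenDiv_integrand_eq μ (le_of_lt hz)),
    integral_add (h.integrable_cross 1 μ) (h.integrable_outputDensity_mul_id 1),
    h.integral_outputDensity_mul_id, cross]

theorem measurable_mainIntegrand (θ : ℝ) (μ₁ : ProbabilityMeasure ℝ≥0) :
    Measurable (fun p : ℝ≥0 × ℝ => mainIntegrand θ μ₁ p.1 p.2) :=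
  (measurable_density θ).mul ((measurable_density θ).div
    ((measurable_outputDensity θ μ₁).comp measurable_snd)).log

theorem HasMean.integrable_prod_mainIntegrand (h : HasMean μ) (θ : ℝ)
    (μ₁ : ProbabilityMeasure ℝ≥0) :
    Integrable (fun p : ℝ≥0 × ℝ => mainIntegrand θ μ₁ p.1 p.2)
      ((μ : Measure ℝ≥0).prod (volume.restrict (Set.Ioi 0))) := by
  have hL := linearGrowth_log_outputDensity θ μ₁
  have hm := measurable_mainIntegrand θ μ₁
  rw [integrable_prod_iff hm.aestronglyMeasurable]
  refine ⟨.of_forall fun x => integrable_mainIntegrand θ μ₁ x, ?_⟩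
  refine (((h.integrable_log_scale θ).add (integrable_const 1)).add
    ((integrable_const (-Real.log (tailConst θ μ₁))).add (h.integrable_scale θ))).mono'
    hm.norm.stronglyMeasurable.integral_prod_right'.aestronglyMeasurable (.of_forall fun x => ?_)
  rw [Real.norm_eq_abs, abs_of_nonneg (integral_nonneg fun _ => norm_nonneg _)]
  have hs := scale_pos θ x
  have hl := Real.log_nonneg (one_le_scale θ x)
  have i1 := (integrable_density θ x).mul_const (Real.log (scale θ x))
  have i2 := (integrable_density_mul_id θ x).mul_const (scale θ x)⁻¹
  have i3 := (hL.integrable_density_mul θ x).norm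
  have e : ∫ y in Set.Ioi (0 : ℝ), (density θ x y * Real.log (scale θ x)
      + density θ x y * y * (scale θ x)⁻¹
      + ‖density θ x y * Real.log (outputDensity θ μ₁ y)‖) = Real.log (scale θ x) + 1
      + ∫ y in Set.Ioi (0 : ℝ), ‖density θ x y * Real.log (outputDensity θ μ₁ y)‖ := by
    rw [integral_add (i1.fun_add i2) i3, integral_add i1 i2, integral_mul_const, integral_mul_const,
      integral_density, integral_density_mul_id, mul_inv_cancel₀ hs.ne', one_mul]
  calc ∫ y in Set.Ioi (0 : ℝ), ‖mainIntegrand θ μ₁ x y‖ ≤ _ :=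
        setIntegral_mono_on (integrable_mainIntegrand θ μ₁ x).norm ((i1.add i2).add i3)
          measurableSet_Ioi fun y hy => ?_
    _ = _ := e
    _ ≤ _ := by
      have := hL.integral_abs_le θ x
      simp only [Pi.add_apply]
      linarith
  have hy0 : 0 < y := hy
  rw [mainIntegrand_eq θ μ₁ x hy0.le]
  have hd := density_pos θ x y
  refine (norm_sub_le _ _).trans ?_
  simp only [Pi.add_apply]
  gcongr
  refine (norm_sub_le _ _).trans ?_
  rw [mul_neg, norm_neg, Real.norm_of_nonneg (by positivity), Real.norm_of_nonneg (by positivity)]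

theorem mutualInfo_lt_top (h : HasMean μ) (θ : ℝ) : mutualInfo θ μ < ∞ := by
  refine (klDiv_lt_top_iff_of_withDensity (measurable_density θ)
    ((measurable_outputDensity θ μ).comp measurable_snd)
    (.of_forall fun p => density_nonneg θ p.1 p.2)
    ((ae_prod_pos μ).mono fun p hp => outputDensity_pos θ μ hp.le)
    (compProd_channel_eq θ μ) (prod_outputLaw_eq θ μ)).2 ?_
  exact h.integrable_prod_mainIntegrand θ μ

theorem HasMean.toReal_mutualInfo (h : HasMean μ) (θ : ℝ) : (mutualInfo θ μ).toReal
    = -(∫ x, Real.log (scale θ x) ∂(μ : Measure ℝ≥0)) - 1 - cross θ μ μ := by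
  rw [mutualInfo, toReal_klDiv_of_withDensity (measurable_density θ)
    ((measurable_outputDensity θ μ).comp measurable_snd)
    (.of_forall fun p => density_nonneg θ p.1 p.2)
    ((ae_prod_pos μ).mono fun p hp => outputDensity_pos θ μ hp.le)
    (compProd_channel_eq θ μ) (prod_outputLaw_eq θ μ)]
  have e := integral_prod _ (h.integrable_prod_mainIntegrand θ μ)
  simp only [integral_mainIntegrand] at e
  rw [integral_sub ((h.integrable_log_scale θ).fun_neg.sub' (integrable_const 1))
    (h.integrable_crossAt θ μ), integral_sub (h.integrable_log_scale θ).fun_neg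
      (integrable_const 1), integral_neg, h.integral_crossAt] at e
  simpa [mainIntegrand] using e

end RelativeEntropy

/-! ### Injectivity of the channel, Gibbs' inequality and bounds on the value -/

section Gibbs

variable {μ μ₁ : ProbabilityMeasure ℝ≥0} {θ : ℝ}

theorem continuousOn_outputDensity (θ : ℝ) (μ : ProbabilityMeasure ℝ≥0) :
    ContinuousOn (outputDensity θ μ) (Set.Ioi 0) := by
  refine continuousOn_of_dominated (bound := fun _ => 1)
    (fun y _ => (continuous_density_left θ y).aestronglyMeasurable)
    (fun y hy => .of_forall fun x => ?_) (integrable_const _)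
    (.of_forall fun x => (continuous_density_right θ x).continuousOn)
  rw [Real.norm_eq_abs, abs_of_pos (density_pos θ x y)]
  exact density_le_one θ x (le_of_lt hy)

theorem scale_injective (hθ : θ ≠ 0) : Function.Injective (scale θ) := by
  intro a b hab
  have h : θ ^ 2 * (a : ℝ) = θ ^ 2 * (b : ℝ) := add_right_cancel hab
  exact NNReal.coe_injective (mul_left_cancel₀ (pow_ne_zero 2 hθ) h)

/-- The function `x ↦ exp (-1 / scale θ x)` as a bounded continuous function. -/
def expScale (θ : ℝ) : BoundedContinuousFunction ℝ≥0 ℝ :=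
  BoundedContinuousFunction.ofNormedAddCommGroup (fun x => Real.exp (-1 / scale θ x))
    (Real.continuous_exp.comp (continuous_const.div (continuous_scale θ)
      fun x => (scale_pos θ x).ne')) 1 (fun x => by
      rw [Real.norm_eq_abs, abs_of_pos (Real.exp_pos _), Real.exp_le_one_iff]
      exact div_nonpos_of_nonpos_of_nonneg (by norm_num) (scale_pos θ x).le)

theorem expScale_apply (θ : ℝ) (x : ℝ≥0) : expScale θ x = Real.exp (-1 / scale θ x) := rfl

/-- The star subalgebra of polynomials in `expScale θ`. -/
def expScaleAlgebra (θ : ℝ) : StarSubalgebra ℝ (BoundedContinuousFunction ℝ≥0 ℝ) where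
  toSubalgebra := (Polynomial.aeval (expScale θ)).range
  star_mem' := fun {a} ha => by
    have : star a = a := by
      ext x
      simp
    rwa [this]

/-- For θ ≠ 0 the function e^{-1/s(x)} is injective, so its polynomials form a point-separating
algebra of bounded continuous functions, and such an algebra determines finite measures. -/
theorem measure_eq_of_integral_expScale_pow (hθ : θ ≠ 0) {P P' : Measure ℝ≥0}
    [IsFiniteMeasure P] [IsFiniteMeasure P']
    (h : ∀ n : ℕ, ∫ x, expScale θ x ^ n ∂P = ∫ x, expScale θ x ^ n ∂P') : P = P' := by
  refine ext_of_forall_mem_subalgebra_integral_eq_of_polish (𝕜 := ℝ) (A := expScaleAlgebra θ)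
    ?_ ?_
  · intro a b hab
    refine ⟨expScale θ, ⟨BoundedContinuousFunction.toContinuousMapStarₐ ℝ (expScale θ), ?_, rfl⟩,
      ?_⟩
    · exact ⟨expScale θ, ⟨Polynomial.X, by simp⟩, rfl⟩
    · change Real.exp (-1 / scale θ a) ≠ Real.exp (-1 / scale θ b)
      intro he
      have h1 := Real.exp_injective he
      have ha := scale_pos θ a
      have hb := scale_pos θ b
      rw [div_eq_div_iff ha.ne' hb.ne'] at h1
      exact hab (scale_injective hθ (by linarith))
  · rintro g ⟨p, rfl⟩
    have key : ∫ x, (Polynomial.aeval (expScale θ) p) x ∂P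
        = ∫ x, (Polynomial.aeval (expScale θ) p) x ∂P' := by
      refine Polynomial.induction_on' (motive := fun p =>
        ∫ x, (Polynomial.aeval (expScale θ) p) x ∂P
          = ∫ x, (Polynomial.aeval (expScale θ) p) x ∂P') p (fun p q hp hq => ?_) fun n a => ?_
      · simp only [map_add, BoundedContinuousFunction.coe_add, Pi.add_apply]
        rw [integral_add (BoundedContinuousFunction.integrable P _)
          (BoundedContinuousFunction.integrable P _), integral_add
          (BoundedContinuousFunction.integrable P' _) (BoundedContinuousFunction.integrable P' _),
          hp, hq]
      · simp only [Polynomial.aeval_monomial]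
        have e : ∀ x, ((algebraMap ℝ (BoundedContinuousFunction ℝ≥0 ℝ)) a * expScale θ ^ n) x
            = a * expScale θ x ^ n := fun x => by simp
        simp only [e, integral_const_mul, h n]
    exact key

/-- The input law is determined by the density of the output law. -/
theorem eq_of_outputDensity_eq (hθ : θ ≠ 0)
    (h : ∀ y, 0 < y → outputDensity θ μ y = outputDensity θ μ₁ y) : μ = μ₁ := by
  have hm : Measurable fun x => ENNReal.ofReal (density θ x 1) :=
    (continuous_density_left θ 1).measurable.ennreal_ofReal
  have hfin : ∀ m : ProbabilityMeasure ℝ≥0, IsFiniteMeasure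
      ((m : Measure ℝ≥0).withDensity fun x => ENNReal.ofReal (density θ x 1)) := fun m =>
    isFiniteMeasure_withDensity_ofReal (integrable_density_left θ m zero_le_one).2
  -- Weighting by the density at y = 1 turns the n-th moment into the output density at n + 1, which
  -- is positive even for n = 0. The positive weight is divided out at the end.
  have hint : ∀ m : ProbabilityMeasure ℝ≥0, ∀ n : ℕ, ∫ x, expScale θ x ^ n
      ∂((m : Measure ℝ≥0).withDensity fun x => ENNReal.ofReal (density θ x 1))
      = outputDensity θ m (n + 1) := by
    intro m n
    rw [integral_withDensity_eq_integral_toReal_smul hm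
      (.of_forall fun _ => ENNReal.ofReal_lt_top)]
    refine integral_congr_ae (.of_forall fun x => ?_)
    simp only
    rw [ENNReal.toReal_ofReal (density_nonneg θ x 1), expScale_apply, ← Real.exp_nat_mul,
      density_eq, density_eq, smul_eq_mul, mul_assoc, ← Real.exp_add]
    congr 2
    ring
  have hw : (μ : Measure ℝ≥0).withDensity (fun x => ENNReal.ofReal (density θ x 1))
      = (μ₁ : Measure ℝ≥0).withDensity (fun x => ENNReal.ofReal (density θ x 1)) := by
    have := hfin μ
    have := hfin μ₁
    refine measure_eq_of_integral_expScale_pow hθ fun n => ?_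
    rw [hint, hint, h _ (by positivity)]
  have hinv : ∀ m : ProbabilityMeasure ℝ≥0, ((m : Measure ℝ≥0).withDensity
      fun x => ENNReal.ofReal (density θ x 1)).withDensity
        (fun x => (ENNReal.ofReal (density θ x 1))⁻¹) = m := fun m =>
    withDensity_inv_same hm
      (.of_forall fun x => (ENNReal.ofReal_pos.2 (density_pos θ x 1)).ne')
      (.of_forall fun x => ENNReal.ofReal_ne_top)
  apply ProbabilityMeasure.toMeasure_injective
  rw [← hinv μ, hw, hinv μ₁]

/-- Gibbs' inequality for the output laws. -/
theorem HasMean.cross_le (h : HasMean μ) (h₁ : HasMean μ₁) (θ : ℝ) :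
    cross θ μ μ₁ ≤ cross θ μ μ := by
  have hd : cross θ μ μ₁ - cross θ μ μ ≤ ∫ y in Set.Ioi (0 : ℝ),
      (outputDensity θ μ₁ y - outputDensity θ μ y) := by
    rw [cross, cross, ← integral_sub (h.integrable_cross θ μ₁) (h.integrable_cross θ μ)]
    exact setIntegral_mono_on ((h.integrable_cross θ μ₁).sub (h.integrable_cross θ μ))
      ((h₁.integrable_outputDensity θ).sub (h.integrable_outputDensity θ)) measurableSet_Ioi
      fun y hy => mul_log_sub_log_le (outputDensity_pos θ μ (le_of_lt hy))
        (outputDensity_pos θ μ₁ (le_of_lt hy))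
  rw [integral_sub (h₁.integrable_outputDensity θ) (h.integrable_outputDensity θ),
    h₁.integral_outputDensity, h.integral_outputDensity, sub_self] at hd
  linarith

theorem eq_of_mul_log_sub_log_eq {p q : ℝ} (hp : 0 < p) (hq : 0 < q)
    (h : p * Real.log q - p * Real.log p = q - p) : q = p := by
  by_contra hne
  have h1 : q / p ≠ 1 := fun h => hne ((div_eq_one_iff_eq hp.ne').1 h)
  have h2 := Real.log_lt_sub_one_of_pos (div_pos hq hp) h1
  rw [Real.log_div hq.ne' hp.ne'] at h2
  have := mul_lt_mul_of_pos_left h2 hp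
  have e : p * (q / p - 1) = q - p := by field_simp
  linarith

/-- The defect in the pointwise Gibbs inequality is nonnegative with integral zero, so the output
densities agree almost everywhere, then everywhere on the half-line by continuity, and injectivity
applies. -/
theorem HasMean.eq_of_cross_eq (h : HasMean μ) (h₁ : HasMean μ₁) (hθ : θ ≠ 0)
    (he : cross θ μ μ ≤ cross θ μ μ₁) : μ = μ₁ := by
  have i1 := (h₁.integrable_outputDensity θ).sub' (h.integrable_outputDensity θ)
  have i2 := (h.integrable_cross θ μ₁).sub' (h.integrable_cross θ μ)
  have h0 : ∫ y in Set.Ioi (0 : ℝ), ((outputDensity θ μ₁ y - outputDensity θ μ y)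
      - (outputDensity θ μ y * Real.log (outputDensity θ μ₁ y)
        - outputDensity θ μ y * Real.log (outputDensity θ μ y))) = 0 := by
    rw [integral_sub i1 i2, integral_sub (h₁.integrable_outputDensity θ)
      (h.integrable_outputDensity θ), integral_sub (h.integrable_cross θ μ₁)
      (h.integrable_cross θ μ), h₁.integral_outputDensity, h.integral_outputDensity]
    change 1 - 1 - (cross θ μ μ₁ - cross θ μ μ) = 0
    have := h.cross_le h₁ θ
    linarith
  rw [integral_eq_zero_iff_of_nonneg_ae ?_ (i1.sub' i2)] at h0
  · have hae : outputDensity θ μ₁ =ᵐ[volume.restrict (Set.Ioi 0)] outputDensity θ μ := by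
      filter_upwards [h0, ae_Ioi_pos] with y hy hy0
      exact eq_of_mul_log_sub_log_eq (outputDensity_pos θ μ hy0.le)
        (outputDensity_pos θ μ₁ hy0.le) (sub_eq_zero.1 hy).symm
    have := Measure.eqOn_open_of_ae_eq hae isOpen_Ioi (continuousOn_outputDensity θ μ₁)
      (continuousOn_outputDensity θ μ)
    exact eq_of_outputDensity_eq hθ fun y hy => (this hy).symm
  · filter_upwards [ae_Ioi_pos] with y hy
    exact sub_nonneg.2 (mul_log_sub_log_le (outputDensity_pos θ μ hy.le)
      (outputDensity_pos θ μ₁ hy.le))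

/-- The input law that is concentrated at `x`. -/
def diracLaw (x : ℝ≥0) : ProbabilityMeasure ℝ≥0 := ⟨Measure.dirac x, inferInstance⟩

theorem integral_diracLaw (f : ℝ≥0 → ℝ) (x : ℝ≥0) :
    ∫ t, f t ∂(diracLaw x : Measure ℝ≥0) = f x :=
  integral_dirac f x

theorem hasMean_diracLaw (x : ℝ≥0) : HasMean (diracLaw x) :=
  integrable_dirac (by simp)

theorem outputDensity_diracLaw (θ : ℝ) (x : ℝ≥0) (y : ℝ) :
    outputDensity θ (diracLaw x) y = density θ x y :=
  integral_diracLaw _ x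

/-- The logarithm of an exponential density is affine, so only the output mean of μ enters. -/
theorem HasMean.cross_diracLaw (h : HasMean μ) (θ : ℝ) (x : ℝ≥0) :
    cross θ μ (diracLaw x)
      = -Real.log (scale θ x) - (∫ t, scale θ t ∂(μ : Measure ℝ≥0)) / scale θ x := by
  have e : ∀ y, outputDensity θ μ y * Real.log (outputDensity θ (diracLaw x) y)
      = outputDensity θ μ y * (-Real.log (scale θ x))
        - outputDensity θ μ y * y * (scale θ x)⁻¹ := fun y => by
    rw [outputDensity_diracLaw, log_density]
    ring
  simp only [cross, e]
  rw [integral_sub ((h.integrable_outputDensity θ).mul_const _)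
    ((h.integrable_outputDensity_mul_id θ).mul_const _), integral_mul_const, integral_mul_const,
    h.integral_outputDensity, h.integral_outputDensity_mul_id]
  ring

theorem HasMean.integral_scale (h : HasMean μ) (θ : ℝ) :
    ∫ x, scale θ x ∂(μ : Measure ℝ≥0) = θ ^ 2 * (∫ x, (x : ℝ) ∂(μ : Measure ℝ≥0)) + 1 := by
  unfold scale
  rw [integral_add (Integrable.const_mul h _) (integrable_const 1), integral_const_mul]
  simp

theorem HasMean.exists_mean (h : HasMean μ) :
    ∃ m : ℝ≥0, ∀ θ, ∫ x, scale θ x ∂(μ : Measure ℝ≥0) = scale θ m :=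
  ⟨⟨∫ x, (x : ℝ) ∂(μ : Measure ℝ≥0), integral_nonneg fun x => x.2⟩, fun θ => h.integral_scale θ⟩

/-- A bound for the mean `m` of an input law in terms of the divergence at the warden. -/
theorem HasMean.mean_le (h : HasMean μ) {m : ℝ≥0}
    (hm : ∀ θ, ∫ x, scale θ x ∂(μ : Measure ℝ≥0) = scale θ m) {ν ε : ℝ} (hε : 0 < ε)
    (hD : (wardenDiv μ).toReal ≤ ν) : (m : ℝ) ≤ ε + ν * (1 + ε) / ε := by
  -- The exponential law maximizes entropy at a given mean, whence m - log(1 + m) ≤ ν.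
  have h1 := h.cross_le (hasMean_diracLaw m) 1
  rw [h.cross_diracLaw, hm, div_self (scale_pos 1 m).ne'] at h1
  rw [h.toReal_wardenDiv, hm] at hD
  have hs : scale 1 m = 1 + m := by
    unfold scale
    ring
  rw [hs] at h1 hD
  have hm0 : (0 : ℝ) ≤ m := m.2
  -- The tangent to the logarithm at 1 + ε makes the inequality for m linear.
  have h2 := Real.log_le_sub_one_of_pos (show 0 < (1 + (m : ℝ)) / (1 + ε) by positivity)
  rw [Real.log_div (by positivity) (by positivity)] at h2
  have h3 := Real.log_le_sub_one_of_pos (show 0 < 1 + ε by positivity)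
  have h4 : (1 + (m : ℝ)) / (1 + ε) - 1 = (m - ε) / (1 + ε) := by
    field_simp
    ring
  have h5 : (m : ℝ) - ε - (m - ε) / (1 + ε) ≤ ν := by linarith
  have h6 : (m : ℝ) - ε - (m - ε) / (1 + ε) = (m - ε) * ε / (1 + ε) := by
    field_simp
    ring
  rw [h6, div_le_iff₀ (by positivity)] at h5
  have h7 : (m : ℝ) - ε ≤ ν * (1 + ε) / ε := by rwa [le_div_iff₀ hε]
  linarith

/-- The output entropy is at most that of the exponential law with the same mean, and the
conditional entropy is at least 1; log(1 + u) ≤ u finishes. -/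
theorem HasMean.mutualInfo_le (h : HasMean μ) {m : ℝ≥0}
    (hm : ∀ θ, ∫ x, scale θ x ∂(μ : Measure ℝ≥0) = scale θ m) (θ : ℝ) :
    (mutualInfo θ μ).toReal ≤ θ ^ 2 * m := by
  have h1 := h.cross_le (hasMean_diracLaw m) θ
  rw [h.cross_diracLaw, hm, div_self (scale_pos θ m).ne'] at h1
  rw [h.toReal_mutualInfo]
  have h2 : 0 ≤ ∫ x, Real.log (scale θ x) ∂(μ : Measure ℝ≥0) :=
    integral_nonneg fun x => Real.log_nonneg (one_le_scale θ x)
  have h3 := Real.log_le_sub_one_of_pos (scale_pos θ m)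
  have h4 : scale θ m - 1 = θ ^ 2 * m := by
    unfold scale
    ring
  linarith

theorem wardenDiv_diracLaw_zero : wardenDiv (diracLaw 0) = 0 := by
  have : outputLaw 1 (diracLaw 0) = channel 1 0 := Measure.dirac_bind (channel 1).measurable 0
  rw [wardenDiv, this, klDiv_self]

theorem diracLaw_zero_mem_feasible (ν : ℝ) : diracLaw 0 ∈ feasible ν :=
  ⟨(mem_inputLaws_iff _).2 (hasMean_diracLaw 0), by rw [wardenDiv_diracLaw_zero]; exact zero_le⟩

theorem mem_feasible_iff {ν : ℝ} (hν : 0 ≤ ν) :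
    μ ∈ feasible ν ↔ HasMean μ ∧ (wardenDiv μ).toReal ≤ ν := by
  refine and_congr_left' (mem_inputLaws_iff μ) |>.trans (and_congr_right fun h => ?_)
  have : wardenDiv μ ≠ ∞ := ((mem_inputLaws_iff μ).2 h : wardenDiv μ < ∞).ne
  exact (ENNReal.le_ofReal_iff_toReal_le this hν)

theorem mutualInfo_le_of_mem_feasible {ν : ℝ} (hν : 0 < ν) (h : μ ∈ feasible ν) (θ : ℝ) :
    (mutualInfo θ μ).toReal ≤ θ ^ 2 * (2 * √ν + ν) := by
  obtain ⟨hμ, hD⟩ := (mem_feasible_iff hν.le).1 h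
  obtain ⟨m, hm⟩ := hμ.exists_mean
  -- Taking ε = √ν makes the bound on the mean tend to 0 with ν.
  have h1 := hμ.mean_le hm (Real.sqrt_pos.2 hν) hD
  have hs := Real.sqrt_pos.2 hν
  have h2 : √ν + ν * (1 + √ν) / √ν = 2 * √ν + ν := by
    field_simp
    rw [Real.sq_sqrt hν.le]
    ring_nf
    rw [show √ν ^ 2 = ν from Real.sq_sqrt hν.le]
    ring
  exact (hμ.mutualInfo_le hm θ).trans (mul_le_mul_of_nonneg_left (h2 ▸ h1) (sq_nonneg θ))

theorem optValue_le {ν : ℝ} (hν : 0 < ν) (θ : ℝ) :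
    optValue θ ν ≤ ENNReal.ofReal (θ ^ 2 * (2 * √ν + ν)) := by
  refine iSup₂_le fun μ h => ?_
  have hμ := ((mem_feasible_iff hν.le).1 h).1
  rw [← ENNReal.ofReal_toReal (mutualInfo_lt_top hμ θ).ne]
  exact ENNReal.ofReal_le_ofReal (mutualInfo_le_of_mem_feasible hν h θ)

theorem optValue_lt_top {ν : ℝ} (hν : 0 < ν) (θ : ℝ) : optValue θ ν < ∞ :=
  (optValue_le hν θ).trans_lt ENNReal.ofReal_lt_top

theorem toReal_mutualInfo_le_optValue {ν : ℝ} (hν : 0 < ν) (h : μ ∈ feasible ν) (θ : ℝ) :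
    (mutualInfo θ μ).toReal ≤ (optValue θ ν).toReal :=
  ENNReal.toReal_mono (optValue_lt_top hν θ).ne (le_iSup₂ (f := fun μ _ => mutualInfo θ μ) μ h)

end Gibbs

/-! ### Compactness, semicontinuity and existence of an optimal law -/

section Existence

variable {μ μ₁ : ProbabilityMeasure ℝ≥0} {θ : ℝ}

/-- Markov's inequality on the intervals [0, n]. -/
theorem isTightMeasureSet_of_lintegral_le {S : Set (Measure ℝ≥0)} {B : ℝ≥0∞} (hB : B ≠ ∞)
    (h : ∀ m ∈ S, ∫⁻ x, (x : ℝ≥0∞) ∂m ≤ B) : IsTightMeasureSet S := by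
  rw [isTightMeasureSet_iff_exists_isCompact_measure_compl_le]
  intro ε hε
  obtain ⟨n, hn⟩ := ENNReal.exists_nat_mul_gt hε.ne' hB
  refine ⟨Set.Icc 0 (n : ℝ≥0), isCompact_Icc, fun m hm => ?_⟩
  have h1 := mul_meas_ge_le_lintegral (μ := m) (f := fun x : ℝ≥0 => (x : ℝ≥0∞))
    measurable_coe_nnreal_ennreal (n : ℝ≥0∞)
  have h2 : m (Set.Icc 0 (n : ℝ≥0))ᶜ ≤ m {x : ℝ≥0 | (n : ℝ≥0∞) ≤ (x : ℝ≥0∞)} := by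
    refine measure_mono fun x hx => ?_
    simp only [Set.mem_compl_iff, Set.mem_Icc, zero_le, true_and, not_le] at hx
    exact_mod_cast hx.le
  by_contra! hlt
  have h3 : (n : ℝ≥0∞) * ε ≤ n * m {x : ℝ≥0 | (n : ℝ≥0∞) ≤ (x : ℝ≥0∞)} := by
    gcongr
    exact hlt.le.trans h2
  exact absurd (h3.trans (h1.trans (h m hm))) (not_le.2 hn)

theorem HasMean.lintegral_coe (h : HasMean μ) :
    ∫⁻ x : ℝ≥0, (x : ℝ≥0∞) ∂(μ : Measure ℝ≥0)
      = ENNReal.ofReal (∫ x : ℝ≥0, (x : ℝ) ∂(μ : Measure ℝ≥0)) := by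
  rw [ofReal_integral_eq_lintegral_ofReal h (.of_forall fun x => x.2)]
  simp

section Limit

variable {u : ℕ → ProbabilityMeasure ℝ≥0}

theorem tendsto_outputDensity (hu : Tendsto u atTop (𝓝 μ)) (θ : ℝ) {y : ℝ} (hy : 0 ≤ y) :
    Tendsto (fun n => outputDensity θ (u n) y) atTop (𝓝 (outputDensity θ μ y)) :=
  ProbabilityMeasure.tendsto_iff_forall_integral_tendsto.1 hu
    (BoundedContinuousFunction.ofNormedAddCommGroup (fun x => density θ x y)
      (continuous_density_left θ y) 1 fun x => by
        rw [Real.norm_eq_abs, abs_of_pos (density_pos θ x y)]; exact density_le_one θ x hy)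

theorem lintegral_le_liminf_of_tendsto (hu : Tendsto u atTop (𝓝 μ)) {f : ℝ≥0 → ℝ}
    (hf : Continuous f) (h0 : 0 ≤ f) :
    ∫⁻ x, ENNReal.ofReal (f x) ∂(μ : Measure ℝ≥0)
      ≤ liminf (fun n => ∫⁻ x, ENNReal.ofReal (f x) ∂(u n : Measure ℝ≥0)) atTop :=
  lintegral_le_liminf_lintegral_of_forall_isOpen_measure_le_liminf_measure hf h0
    fun _ hG => ProbabilityMeasure.le_liminf_measure_open_of_tendsto hu hG

theorem eventually_lt_of_ofReal_le_liminf {a : ℝ} {b : ℕ → ℝ} (hb : ∀ n, 0 ≤ b n)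
    (h : ENNReal.ofReal a ≤ liminf (fun n => ENNReal.ofReal (b n)) atTop) {r : ℝ} (hr : r < a) :
    ∀ᶠ n in atTop, r < b n := by
  rcases lt_or_ge r 0 with h0 | h0
  · exact .of_forall fun n => h0.trans_le (hb n)
  · have h1 : ENNReal.ofReal r < liminf (fun n => ENNReal.ofReal (b n)) atTop :=
      ((ENNReal.ofReal_lt_ofReal_iff (h0.trans_lt hr)).2 hr).trans_le h
    filter_upwards [eventually_lt_of_lt_liminf h1] with n hn
    exact (ENNReal.ofReal_lt_ofReal_iff_of_nonneg h0).1 hn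

theorem hasMean_of_tendsto (hu : Tendsto u atTop (𝓝 μ)) {B : ℝ}
    (hB : ∀ n, ∫⁻ x : ℝ≥0, (x : ℝ≥0∞) ∂(u n : Measure ℝ≥0) ≤ ENNReal.ofReal B) : HasMean μ := by
  have h := lintegral_le_liminf_of_tendsto hu NNReal.continuous_coe (fun x => x.2)
  simp only [ENNReal.ofReal_coe_nnreal] at h
  refine ⟨NNReal.continuous_coe.aestronglyMeasurable, ?_⟩
  rw [hasFiniteIntegral_iff_ofReal (.of_forall fun x => x.2)]
  simp only [ENNReal.ofReal_coe_nnreal]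
  refine (h.trans (liminf_le_of_frequently_le' (Frequently.of_forall hB))).trans_lt
    ENNReal.ofReal_lt_top

/-- Integrals of nonnegative continuous functions, even unbounded ones, are lower semicontinuous
under weak convergence. -/
theorem eventually_lt_integral_log_scale (hu : Tendsto u atTop (𝓝 μ)) (hμ : HasMean μ)
    (hn : ∀ n, HasMean (u n)) (θ : ℝ) {r : ℝ}
    (hr : r < ∫ x, Real.log (scale θ x) ∂(μ : Measure ℝ≥0)) :
    ∀ᶠ n in atTop, r < ∫ x, Real.log (scale θ x) ∂(u n : Measure ℝ≥0) := by
  have h0 : ∀ x, 0 ≤ Real.log (scale θ x) := fun x => Real.log_nonneg (one_le_scale θ x)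
  have h := lintegral_le_liminf_of_tendsto hu
    ((continuous_scale θ).log fun x => (scale_pos θ x).ne') h0
  simp only [← ofReal_integral_eq_lintegral_ofReal (hμ.integrable_log_scale θ) (.of_forall h0),
    fun n => (ofReal_integral_eq_lintegral_ofReal ((hn n).integrable_log_scale θ)
      (.of_forall h0)).symm] at h
  exact eventually_lt_of_ofReal_le_liminf (fun n => integral_nonneg h0) h hr

/-- The integrand of the relative entropy with respect to the measure with density `e^{-cy}`. -/
def entropyIntegrand (θ c : ℝ) (μ : ProbabilityMeasure ℝ≥0) (y : ℝ) : ℝ :=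
  outputDensity θ μ y * Real.log (outputDensity θ μ y) + c * (outputDensity θ μ y * y)
    - outputDensity θ μ y + Real.exp (-c * y)

theorem entropyIntegrand_nonneg (θ c : ℝ) (μ : ProbabilityMeasure ℝ≥0) {y : ℝ} (hy : 0 ≤ y) :
    0 ≤ entropyIntegrand θ c μ y := by
  have := mul_log_sub_log_le (outputDensity_pos θ μ hy) (Real.exp_pos (-c * y))
  rw [Real.log_exp] at this
  unfold entropyIntegrand
  linarith

theorem HasMean.integrable_entropyIntegrand (h : HasMean μ) (θ : ℝ) {c : ℝ} (hc : 0 < c) :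
    IntegrableOn (entropyIntegrand θ c μ) (Set.Ioi 0) :=
  (((h.integrable_cross θ μ).add ((h.integrable_outputDensity_mul_id θ).const_mul c)).sub
    (h.integrable_outputDensity θ)).add (integrableOn_exp_mul_Ioi (neg_neg_of_pos hc) 0)

theorem HasMean.integral_entropyIntegrand (h : HasMean μ) (θ : ℝ) {c : ℝ} (hc : 0 < c) :
    ∫ y in Set.Ioi (0 : ℝ), entropyIntegrand θ c μ y
      = cross θ μ μ + c * (∫ x, scale θ x ∂(μ : Measure ℝ≥0)) - 1 + 1 / c := by
  have i1 := h.integrable_cross θ μ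
  have i2 := (h.integrable_outputDensity_mul_id θ).const_mul c
  unfold entropyIntegrand
  rw [integral_add ((i1.fun_add i2).sub' (h.integrable_outputDensity θ))
    (integrableOn_exp_mul_Ioi (neg_neg_of_pos hc) 0), integral_sub (i1.fun_add i2)
    (h.integrable_outputDensity θ), integral_add i1 i2, integral_const_mul,
    h.integral_outputDensity, h.integral_outputDensity_mul_id,
    integral_exp_mul_Ioi (neg_neg_of_pos hc) 0, cross]
  simp

theorem tendsto_entropyIntegrand (hu : Tendsto u atTop (𝓝 μ)) (θ c : ℝ) {y : ℝ} (hy : 0 ≤ y) :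
    Tendsto (fun n => entropyIntegrand θ c (u n) y) atTop (𝓝 (entropyIntegrand θ c μ y)) := by
  have h := tendsto_outputDensity hu θ hy
  exact (((h.mul (h.log (outputDensity_pos θ μ hy).ne')).add ((h.mul_const y).const_mul c)).sub
    h).add_const _

theorem measurable_entropyIntegrand (θ c : ℝ) (μ : ProbabilityMeasure ℝ≥0) :
    Measurable (entropyIntegrand θ c μ) := by
  have := measurable_outputDensity θ μ
  unfold entropyIntegrand
  fun_prop

/-- Output densities converge pointwise, and adding c y f - f + e^{-cy} makes f log f nonnegative,
so Fatou applies. The case c = 1 is the divergence at the warden; small c serves the mutual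
information. -/
theorem eventually_lt_cross_add (hu : Tendsto u atTop (𝓝 μ)) (hμ : HasMean μ)
    (hn : ∀ n, HasMean (u n)) (θ : ℝ) {c r : ℝ} (hc : 0 < c)
    (hr : r < cross θ μ μ + c * ∫ x, scale θ x ∂(μ : Measure ℝ≥0)) :
    ∀ᶠ n in atTop, r < cross θ (u n) (u n) + c * ∫ x, scale θ x ∂(u n : Measure ℝ≥0) := by
  have h : ∫⁻ y in Set.Ioi (0 : ℝ), ENNReal.ofReal (entropyIntegrand θ c μ y)
      ≤ liminf (fun n => ∫⁻ y in Set.Ioi (0 : ℝ),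
        ENNReal.ofReal (entropyIntegrand θ c (u n) y)) atTop := by
    refine le_trans (le_of_eq (lintegral_congr_ae ?_)) (lintegral_liminf_le fun n =>
      (measurable_entropyIntegrand θ c (u n)).ennreal_ofReal)
    filter_upwards [ae_Ioi_pos] with y hy
    exact ((ENNReal.continuous_ofReal.tendsto _).comp
      (tendsto_entropyIntegrand hu θ c hy.le)).liminf_eq.symm
  have h0 : ∀ m, 0 ≤ᵐ[volume.restrict (Set.Ioi 0)] entropyIntegrand θ c m := fun m =>
    ae_Ioi_pos.mono fun y hy => entropyIntegrand_nonneg θ c m hy.le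
  simp only [← ofReal_integral_eq_lintegral_ofReal (hμ.integrable_entropyIntegrand θ hc) (h0 μ),
    fun n => (ofReal_integral_eq_lintegral_ofReal ((hn n).integrable_entropyIntegrand θ hc)
      (h0 (u n))).symm] at h
  have hr' : r - 1 + 1 / c < ∫ y in Set.Ioi (0 : ℝ), entropyIntegrand θ c μ y := by
    rw [hμ.integral_entropyIntegrand θ hc]
    linarith
  filter_upwards [eventually_lt_of_ofReal_le_liminf
    (fun n => integral_nonneg_of_ae (h0 (u n))) h hr'] with n hlt
  rw [(hn n).integral_entropyIntegrand θ hc] at hlt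
  linarith

theorem wardenDiv_le_of_tendsto (hu : Tendsto u atTop (𝓝 μ)) (hμ : HasMean μ)
    (hn : ∀ n, HasMean (u n)) {ν : ℝ} (h : ∀ n, (wardenDiv (u n)).toReal ≤ ν) :
    (wardenDiv μ).toReal ≤ ν := by
  by_contra! hlt
  rw [hμ.toReal_wardenDiv, ← one_mul (∫ x, scale 1 x ∂(μ : Measure ℝ≥0))] at hlt
  obtain ⟨n, hN⟩ := (eventually_lt_cross_add hu hμ hn 1 one_pos hlt).exists
  have := h n
  rw [(hn n).toReal_wardenDiv] at this
  linarith

/-- The mean need not converge, but it stays bounded, so the correction c times the mean that Fatou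
requires costs arbitrarily little. -/
theorem le_mutualInfo_of_tendsto (hu : Tendsto u atTop (𝓝 μ)) (hμ : HasMean μ)
    (hn : ∀ n, HasMean (u n)) {θ B a : ℝ}
    (hB : ∀ n, ∫ x, scale θ x ∂(u n : Measure ℝ≥0) ≤ B)
    (ha : Tendsto (fun n => (mutualInfo θ (u n)).toReal) atTop (𝓝 a)) :
    a ≤ (mutualInfo θ μ).toReal := by
  have hs : ∀ m : ProbabilityMeasure ℝ≥0, 0 ≤ ∫ x, scale θ x ∂(m : Measure ℝ≥0) := fun m =>
    integral_nonneg fun x => (scale_pos θ x).le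
  have hB0 : 0 ≤ B := (hs (u 0)).trans (hB 0)
  refine le_of_forall_pos_le_add fun ε hε => ?_
  -- The correction costs at most ε/3 and the two semicontinuity losses ε/4 each; the sum stays
  -- below ε.
  set c := ε / (3 * (B + 1)) with hcdef
  have hc : 0 < c := by positivity
  have hcB : c * B ≤ ε / 3 := by
    rw [hcdef, div_mul_eq_mul_div, div_le_div_iff₀ (by positivity) (by positivity)]
    nlinarith
  refine le_of_tendsto ha ?_
  filter_upwards [eventually_lt_integral_log_scale hu hμ hn θ (sub_lt_self _ (half_pos (half_pos hε))),
    eventually_lt_cross_add hu hμ hn θ hc (sub_lt_self _ (half_pos (half_pos hε)))] with n h1 h2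
  rw [hμ.toReal_mutualInfo, (hn n).toReal_mutualInfo]
  have h3 := mul_le_mul_of_nonneg_left (hB n) hc.le
  have h4 := mul_nonneg hc.le (hs μ)
  linarith

end Limit

/-- The supremum in the definition of `optValue` is attained. -/
theorem exists_isOptimal (θ : ℝ) {ν : ℝ} (hν : 0 < ν) : ∃ μ, IsOptimal θ ν μ := by
  have hS : (mutualInfo θ '' feasible ν).Nonempty := ⟨_, _, diracLaw_zero_mem_feasible ν, rfl⟩
  obtain ⟨v, -, hv, hvS⟩ := exists_seq_tendsto_sSup hS (OrderTop.bddAbove _)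
  rw [sSup_image] at hv
  choose w hw hwv using hvS
  have hmean : ∀ m ∈ feasible ν, HasMean m ∧
      ∫ x : ℝ≥0, (x : ℝ) ∂(m : Measure ℝ≥0) ≤ 1 + ν * (1 + 1) / 1 := by
    intro m hm
    obtain ⟨h1, h2⟩ := (mem_feasible_iff hν.le).1 hm
    obtain ⟨a, ha⟩ := h1.exists_mean
    have h3 := h1.mean_le ha one_pos h2
    have h4 := ha 1
    rw [h1.integral_scale] at h4
    unfold scale at h4
    exact ⟨h1, by linarith⟩
  set B : ℝ := 1 + ν * (1 + 1) / 1
  have hlint : ∀ m ∈ feasible ν,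
      ∫⁻ x : ℝ≥0, (x : ℝ≥0∞) ∂(m : Measure ℝ≥0) ≤ ENNReal.ofReal B := fun m hm => by
    rw [(hmean m hm).1.lintegral_coe]
    exact ENNReal.ofReal_le_ofReal (hmean m hm).2
  have hcomp : IsCompact (closure (feasible ν)) :=
    isCompact_closure_of_isTightMeasureSet
      (isTightMeasureSet_of_lintegral_le (B := ENNReal.ofReal B) ENNReal.ofReal_ne_top
        (by rintro _ ⟨m, hm, rfl⟩; exact hlint m hm))
  obtain ⟨μ, -, φ, hφ, hμ⟩ := hcomp.tendsto_subseq fun n => subset_closure (hw n)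
  have hn : ∀ n, HasMean (w (φ n)) := fun n => (hmean _ (hw _)).1
  have hμm : HasMean μ := hasMean_of_tendsto hμ fun n => hlint _ (hw (φ n))
  have hfeas : μ ∈ feasible ν := (mem_feasible_iff hν.le).2 ⟨hμm, wardenDiv_le_of_tendsto hμ hμm hn
    fun n => ((mem_feasible_iff hν.le).1 (hw (φ n))).2⟩
  refine ⟨μ, hfeas, ?_⟩
  rw [← ENNReal.toReal_eq_toReal_iff' (mutualInfo_lt_top hμm θ).ne (optValue_lt_top hν θ).ne]
  refine (toReal_mutualInfo_le_optValue hν hfeas θ).antisymm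
    (le_mutualInfo_of_tendsto hμ hμm hn (B := θ ^ 2 * B + 1) (fun n => ?_) ?_)
  · rw [Function.comp_apply, (hn n).integral_scale]
    gcongr
    exact (hmean _ (hw _)).2
  · have h1 : Tendsto (fun n => mutualInfo θ (w (φ n))) atTop (𝓝 (optValue θ ν)) := by
      simp only [hwv]
      exact hv.comp hφ.tendsto_atTop
    exact (ENNReal.tendsto_toReal (optValue_lt_top hν θ).ne).comp h1

end Existence

/-! ### Concavity, first-order conditions and the Lagrange multiplier -/

section Lagrangian

variable {μ μ₀ μ₁ ρ : ProbabilityMeasure ℝ≥0} {θ ν g : ℝ} {t : unitInterval}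

/-- The mixture `(1 - t) μ₀ + t μ₁` of two input laws. -/
def mix (t : unitInterval) (μ₀ μ₁ : ProbabilityMeasure ℝ≥0) : ProbabilityMeasure ℝ≥0 :=
  ⟨ENNReal.ofReal (1 - t) • (μ₀ : Measure ℝ≥0) + ENNReal.ofReal t • (μ₁ : Measure ℝ≥0), ⟨by
    have h1 : (0 : ℝ) ≤ t := t.2.1
    have h2 : (0 : ℝ) ≤ 1 - t := sub_nonneg.2 t.2.2
    simp [← ENNReal.ofReal_add h2 h1]⟩⟩

theorem integrable_mix {f : ℝ≥0 → ℝ} (t : unitInterval) (h₀ : Integrable f (μ₀ : Measure ℝ≥0))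
    (h₁ : Integrable f (μ₁ : Measure ℝ≥0)) : Integrable f (mix t μ₀ μ₁ : Measure ℝ≥0) :=
  (h₀.smul_measure ENNReal.ofReal_ne_top).add_measure (h₁.smul_measure ENNReal.ofReal_ne_top)

theorem integral_mix {f : ℝ≥0 → ℝ} (t : unitInterval) (h₀ : Integrable f (μ₀ : Measure ℝ≥0))
    (h₁ : Integrable f (μ₁ : Measure ℝ≥0)) : ∫ x, f x ∂(mix t μ₀ μ₁ : Measure ℝ≥0)
      = (1 - t) * ∫ x, f x ∂(μ₀ : Measure ℝ≥0) + t * ∫ x, f x ∂(μ₁ : Measure ℝ≥0) := by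
  have h1 : (0 : ℝ) ≤ t := t.2.1
  have h2 : (0 : ℝ) ≤ 1 - t := sub_nonneg.2 t.2.2
  change ∫ x, f x ∂(ENNReal.ofReal (1 - t) • (μ₀ : Measure ℝ≥0)
    + ENNReal.ofReal t • (μ₁ : Measure ℝ≥0)) = _
  rw [integral_add_measure (h₀.smul_measure ENNReal.ofReal_ne_top)
    (h₁.smul_measure ENNReal.ofReal_ne_top), integral_smul_measure, integral_smul_measure,
    ENNReal.toReal_ofReal h2, ENNReal.toReal_ofReal h1, smul_eq_mul, smul_eq_mul]

theorem HasMean.mix (h₀ : HasMean μ₀) (h₁ : HasMean μ₁) (t : unitInterval) :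
    HasMean (mix t μ₀ μ₁) :=
  integrable_mix t h₀ h₁

theorem HasMean.cross_mix (h₀ : HasMean μ₀) (h₁ : HasMean μ₁) (t : unitInterval) (θ : ℝ)
    (ρ : ProbabilityMeasure ℝ≥0) :
    cross θ (CovertRayleigh.mix t μ₀ μ₁) ρ = (1 - t) * cross θ μ₀ ρ + t * cross θ μ₁ ρ := by
  rw [← (h₀.mix h₁ t).integral_crossAt, integral_mix t (h₀.integrable_crossAt θ ρ)
    (h₁.integrable_crossAt θ ρ), h₀.integral_crossAt, h₁.integral_crossAt]

theorem outputDensity_mix (t : unitInterval) (θ : ℝ) (μ₀ μ₁ : ProbabilityMeasure ℝ≥0) {y : ℝ}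
    (hy : 0 ≤ y) : outputDensity θ (mix t μ₀ μ₁) y
      = (1 - t) * outputDensity θ μ₀ y + t * outputDensity θ μ₁ y :=
  integral_mix t (integrable_density_left θ μ₀ hy) (integrable_density_left θ μ₁ hy)

/-- Split the cross term of the mixture along its first argument and apply Gibbs to each component
against the mixture. -/
theorem HasMean.wardenDiv_mix_le (h₀ : HasMean μ₀) (h₁ : HasMean μ₁) (t : unitInterval) :
    (wardenDiv (CovertRayleigh.mix t μ₀ μ₁)).toReal
      ≤ (1 - t) * (wardenDiv μ₀).toReal + t * (wardenDiv μ₁).toReal := by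
  have hm := h₀.mix h₁ t
  rw [hm.toReal_wardenDiv, h₀.toReal_wardenDiv, h₁.toReal_wardenDiv, h₀.cross_mix h₁,
    integral_mix t (h₀.integrable_scale 1) (h₁.integrable_scale 1)]
  have a := mul_le_mul_of_nonneg_left (h₀.cross_le hm 1) (sub_nonneg.2 t.2.2)
  have b := mul_le_mul_of_nonneg_left (h₁.cross_le hm 1) t.2.1
  linarith

/-- Once the weight of μ₁ is at most 1/2, the mixed density is at least half that of μ₀, so one
linear majorant of the logarithms serves for dominated convergence. -/
theorem tendsto_cross_mix (hμ : HasMean μ) (θ : ℝ) (μ₀ μ₁ : ProbabilityMeasure ℝ≥0)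
    {s : ℕ → unitInterval} (hs : Tendsto (fun n => (s n : ℝ)) atTop (𝓝 0)) :
    Tendsto (fun n => cross θ μ (mix (s n) μ₀ μ₁)) atTop (𝓝 (cross θ μ μ₀)) := by
  set C := -Real.log (tailConst θ μ₀ / 2)
  have hc : 0 < tailConst θ μ₀ / 2 := half_pos (tailConst_pos θ μ₀)
  refine tendsto_integral_filter_of_dominated_convergence
    (fun y => outputDensity θ μ y * C + outputDensity θ μ y * y) ?_ ?_ ?_ ?_
  · exact .of_forall fun n => ((measurable_outputDensity θ μ).mul
      (measurable_outputDensity θ _).log).aestronglyMeasurable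
  · filter_upwards [hs.eventually_le_const (half_pos one_pos)] with n hn
    filter_upwards [ae_Ioi_pos] with y hy
    have hp := outputDensity_pos θ μ hy.le
    rw [Real.norm_eq_abs, abs_mul, abs_of_pos hp, ← mul_add]
    refine mul_le_mul_of_nonneg_left (abs_log_le_of_bounds hc ?_
      (outputDensity_le_one θ _ hy.le)) hp.le
    rw [outputDensity_mix _ _ _ _ hy.le]
    have h1 := le_outputDensity θ μ₀ hy.le
    have h2 := mul_nonneg (s n).2.1 (outputDensity_nonneg θ μ₁ y)
    have h3 := outputDensity_nonneg θ μ₀ y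
    nlinarith
  · exact ((hμ.integrable_outputDensity θ).mul_const C).add (hμ.integrable_outputDensity_mul_id θ)
  · filter_upwards [ae_Ioi_pos] with y hy
    have h : Tendsto (fun n => outputDensity θ (mix (s n) μ₀ μ₁) y) atTop
        (𝓝 (outputDensity θ μ₀ y)) := by
      simp only [outputDensity_mix _ _ _ _ hy.le]
      simpa using ((hs.const_sub 1).mul_const (outputDensity θ μ₀ y)).add
        (hs.mul_const (outputDensity θ μ₁ y))
    exact (h.log (outputDensity_pos θ μ₀ hy.le).ne').const_mul _

/-- The mean of the function `kktFun` of `ρ` with respect to `μ`. -/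
def kktMean (θ ν g : ℝ) (μ ρ : ProbabilityMeasure ℝ≥0) : ℝ :=
  ∫ x, kktFun θ ν g ρ x ∂(μ : Measure ℝ≥0)

theorem HasMean.kktMean_self (h : HasMean μ) (θ ν g : ℝ) :
    kktMean θ ν g μ μ = lagrangian θ ν g μ := by
  rw [kktMean, h.integral_kktFun, lagrangian, h.toReal_mutualInfo, h.toReal_wardenDiv]

theorem HasMean.kktMean_mix (h₀ : HasMean μ₀) (h₁ : HasMean μ₁) (t : unitInterval) (θ ν g : ℝ)
    (ρ : ProbabilityMeasure ℝ≥0) : kktMean θ ν g (CovertRayleigh.mix t μ₀ μ₁) ρ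
      = (1 - t) * kktMean θ ν g μ₀ ρ + t * kktMean θ ν g μ₁ ρ :=
  integral_mix t (h₀.integrable_kktFun θ ν g ρ) (h₁.integrable_kktFun θ ν g ρ)

/-- Gibbs for both channels; g ≥ 0 makes the two contributions point the same way. -/
theorem HasMean.lagrangian_le_kktMean (h : HasMean μ) (hρ : HasMean ρ) (hg : 0 ≤ g) (θ ν : ℝ) :
    lagrangian θ ν g μ ≤ kktMean θ ν g μ ρ := by
  rw [← h.kktMean_self, kktMean, kktMean, h.integral_kktFun, h.integral_kktFun]
  have h1 := h.cross_le hρ θ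
  have h2 := mul_le_mul_of_nonneg_left (h.cross_le hρ 1) hg
  linarith

/-- The gap is a sum of two nonnegative Gibbs defects. The one of the main channel enters with
weight 1, so equality is strict information even for g = 0. -/
theorem HasMean.eq_of_kktMean_le (h : HasMean μ) (hρ : HasMean ρ) (hg : 0 ≤ g) (hθ : θ ≠ 0)
    (hle : kktMean θ ν g μ ρ ≤ lagrangian θ ν g μ) : μ = ρ := by
  refine h.eq_of_cross_eq hρ hθ ?_
  rw [← h.kktMean_self, kktMean, kktMean, h.integral_kktFun, h.integral_kktFun] at hle
  have h2 := mul_le_mul_of_nonneg_left (h.cross_le hρ 1) hg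
  linarith

/-- Gibbs is applied to μ₀ only. Keeping the exact term for μ₁ makes the first-order condition
available after division by t. -/
theorem HasMean.le_lagrangian_mix (h₀ : HasMean μ₀) (h₁ : HasMean μ₁) (hg : 0 ≤ g)
    (t : unitInterval) (θ ν : ℝ) :
    (1 - t) * lagrangian θ ν g μ₀ + t * kktMean θ ν g μ₁ (CovertRayleigh.mix t μ₀ μ₁)
      ≤ lagrangian θ ν g (CovertRayleigh.mix t μ₀ μ₁) := by
  have hm := h₀.mix h₁ t
  rw [← hm.kktMean_self, h₀.kktMean_mix h₁]
  have := mul_le_mul_of_nonneg_left (h₀.lagrangian_le_kktMean hm hg θ ν) (sub_nonneg.2 t.2.2)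
  linarith

theorem HasMean.lagrangian_concave (h₀ : HasMean μ₀) (h₁ : HasMean μ₁) (hg : 0 ≤ g)
    (t : unitInterval) (θ ν : ℝ) :
    (1 - t) * lagrangian θ ν g μ₀ + t * lagrangian θ ν g μ₁
      ≤ lagrangian θ ν g (CovertRayleigh.mix t μ₀ μ₁) := by
  have := h₀.le_lagrangian_mix h₁ hg t θ ν
  have := mul_le_mul_of_nonneg_left (h₁.lagrangian_le_kktMean (h₀.mix h₁ t) hg θ ν) t.2.1
  linarith

theorem HasMean.mutualInfo_concave (h₀ : HasMean μ₀) (h₁ : HasMean μ₁) (t : unitInterval)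
    (θ : ℝ) : (1 - t) * (mutualInfo θ μ₀).toReal + t * (mutualInfo θ μ₁).toReal
      ≤ (mutualInfo θ (CovertRayleigh.mix t μ₀ μ₁)).toReal := by
  simpa [lagrangian] using h₀.lagrangian_concave h₁ le_rfl t θ 0

/-- A maximizer of the Lagrangian is unique. -/
theorem HasMean.eq_of_lagrangian_eq (h₀ : HasMean μ₀) (h₁ : HasMean μ₁) (hg : 0 ≤ g)
    (hθ : θ ≠ 0) {a : ℝ} (ha : ∀ μ, HasMean μ → lagrangian θ ν g μ ≤ a)
    (e₀ : lagrangian θ ν g μ₀ = a) (e₁ : lagrangian θ ν g μ₁ = a) : μ₀ = μ₁ := by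
  -- At the midpoint, equality in Gibbs forces each of the two laws to equal the mixture.
  set t : unitInterval := ⟨1 / 2, by norm_num, by norm_num⟩
  have ht : (t : ℝ) = 1 / 2 := rfl
  have hm := h₀.mix h₁ t
  have h := ha _ hm
  rw [← hm.kktMean_self, h₀.kktMean_mix h₁, ht] at h
  have k₀ := h₀.lagrangian_le_kktMean hm hg θ ν
  have k₁ := h₁.lagrangian_le_kktMean hm hg θ ν
  rw [h₀.eq_of_kktMean_le (ν := ν) hm hg hθ (by linarith)]
  exact (h₁.eq_of_kktMean_le (ν := ν) hm hg hθ (by linarith)).symm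

theorem tendsto_kktMean_mix (hμ : HasMean μ) (θ ν g : ℝ) (μ₀ μ₁ : ProbabilityMeasure ℝ≥0)
    {s : ℕ → unitInterval} (hs : Tendsto (fun n => (s n : ℝ)) atTop (𝓝 0)) :
    Tendsto (fun n => kktMean θ ν g μ (mix (s n) μ₀ μ₁)) atTop (𝓝 (kktMean θ ν g μ μ₀)) := by
  simp only [kktMean, hμ.integral_kktFun]
  exact ((tendsto_cross_mix hμ θ μ₀ μ₁ hs).const_sub _).sub
    ((((tendsto_cross_mix hμ 1 μ₀ μ₁ hs).add_const _).sub_const _).const_mul _)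

theorem exists_seq_unitInterval : ∃ s : ℕ → unitInterval, (∀ n, (0 : ℝ) < s n) ∧
    Tendsto (fun n => (s n : ℝ)) atTop (𝓝 0) :=
  ⟨fun n => ⟨1 / ((n : ℝ) + 1), by positivity, by
    rw [div_le_one (by positivity)]
    linarith [(Nat.cast_nonneg n : (0 : ℝ) ≤ n)]⟩, fun n => by simp only; positivity,
    tendsto_one_div_add_atTop_nhds_zero_nat⟩

/-- The first-order optimality condition for a maximizer of the Lagrangian. -/
theorem HasMean.kktMean_le_of_isMax (h₀ : HasMean μ₀) (hμ : HasMean μ) (hg : 0 ≤ g)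
    (hmax : ∀ μ, HasMean μ → lagrangian θ ν g μ ≤ lagrangian θ ν g μ₀) :
    kktMean θ ν g μ μ₀ ≤ lagrangian θ ν g μ₀ := by
  obtain ⟨s, hs0, hs⟩ := exists_seq_unitInterval
  refine le_of_tendsto' (tendsto_kktMean_mix hμ θ ν g μ₀ μ hs) fun n => ?_
  have h1 := (h₀.le_lagrangian_mix hμ hg (s n) θ ν).trans (hmax _ (h₀.mix hμ (s n)))
  have h2 : (s n : ℝ) * kktMean θ ν g μ (CovertRayleigh.mix (s n) μ₀ μ)
      ≤ s n * lagrangian θ ν g μ₀ := by linarith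
  exact le_of_mul_le_mul_left h2 (hs0 n)

/-- Crossing the constraint: slopes beyond `ν` do not exceed slopes before `ν`. -/
theorem slope_le_slope (hν : 0 < ν) (h₀ : HasMean μ₀) (h₁ : HasMean μ₁)
    (d₀ : (wardenDiv μ₀).toReal < ν) (d₁ : ν < (wardenDiv μ₁).toReal) (θ : ℝ) :
    ((mutualInfo θ μ₁).toReal - (optValue θ ν).toReal) / ((wardenDiv μ₁).toReal - ν)
      ≤ ((optValue θ ν).toReal - (mutualInfo θ μ₀).toReal) / (ν - (wardenDiv μ₀).toReal) := by
  set D₀ := (wardenDiv μ₀).toReal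
  set D₁ := (wardenDiv μ₁).toReal
  have p₀ : 0 < ν - D₀ := sub_pos.2 d₀
  have p₁ : 0 < D₁ - ν := sub_pos.2 d₁
  have p : 0 < D₁ - D₀ := by linarith
  -- With this weight the interpolated divergence is exactly ν, so by convexity the mixture is
  -- feasible.
  set t : unitInterval := ⟨(ν - D₀) / (D₁ - D₀), by positivity,
    (div_le_one p).2 (by linarith)⟩
  have ht : (t : ℝ) * (D₁ - D₀) = ν - D₀ := div_mul_cancel₀ _ p.ne'
  have hf : CovertRayleigh.mix t μ₀ μ₁ ∈ feasible ν := by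
    refine (mem_feasible_iff hν.le).2 ⟨h₀.mix h₁ t, (h₀.wardenDiv_mix_le h₁ t).trans ?_⟩
    change (1 - t) * D₀ + t * D₁ ≤ ν
    linarith
  have h := (h₀.mutualInfo_concave h₁ t θ).trans (toReal_mutualInfo_le_optValue hν hf θ)
  rw [div_le_div_iff₀ p₁ p₀]
  have h2 := mul_le_mul_of_nonneg_right h p.le
  have e : ∀ a b : ℝ, ((1 - t) * a + t * b) * (D₁ - D₀) = (D₁ - ν) * a + (ν - D₀) * b := by
    intro a b
    linear_combination (b - a) * ht
  rw [e] at h2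
  linarith

/-- Existence of a Lagrange multiplier for the covertness constraint. -/
theorem exists_multiplier (θ : ℝ) (hν : 0 < ν) : ∃ g : ℝ, 0 ≤ g ∧
    ∀ μ, HasMean μ → lagrangian θ ν g μ ≤ (optValue θ ν).toReal := by
  set A := (optValue θ ν).toReal
  -- The slopes of gain beyond the constraint; 0 is inserted to make the supremum nonnegative and
  -- the set nonempty.
  set S : Set ℝ := insert 0 {r | ∃ μ, HasMean μ ∧ ν < (wardenDiv μ).toReal ∧
    ((mutualInfo θ μ).toReal - A) / ((wardenDiv μ).toReal - ν) = r}
  have hS : ∀ μ, HasMean μ → (wardenDiv μ).toReal < ν → ∀ r ∈ S,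
      r ≤ (A - (mutualInfo θ μ).toReal) / (ν - (wardenDiv μ).toReal) := by
    rintro μ hμ hd r (rfl | ⟨μ', hμ', hd', rfl⟩)
    · have := toReal_mutualInfo_le_optValue hν ((mem_feasible_iff hν.le).2 ⟨hμ, hd.le⟩) θ
      exact div_nonneg (sub_nonneg.2 this) (sub_pos.2 hd).le
    · exact slope_le_slope hν hμ hμ' hd hd' θ
  -- Slater's condition: δ₀ has divergence 0 < ν and supplies a finite upper slope.
  have hbdd : BddAbove S := ⟨_, hS _ (hasMean_diracLaw 0) (by
    rw [wardenDiv_diracLaw_zero]; exact hν)⟩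
  refine ⟨sSup S, le_csSup hbdd (Set.mem_insert _ _), fun μ hμ => ?_⟩
  rw [lagrangian]
  rcases lt_trichotomy (wardenDiv μ).toReal ν with hd | hd | hd
  · have h := csSup_le (Set.insert_nonempty _ _) (hS μ hμ hd)
    rw [le_div_iff₀ (sub_pos.2 hd)] at h
    linarith
  · have := toReal_mutualInfo_le_optValue hν ((mem_feasible_iff hν.le).2 ⟨hμ, hd.le⟩) θ
    rw [hd, sub_self, mul_zero, sub_zero]
    exact this
  · have h := le_csSup hbdd (Set.mem_insert_of_mem _ ⟨μ, hμ, hd, rfl⟩)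
    rw [div_le_iff₀ (sub_pos.2 hd)] at h
    linarith

theorem IsOptimal.lagrangian_eq (hν : 0 < ν) (hg : 0 ≤ g)
    (hmax : ∀ μ, HasMean μ → lagrangian θ ν g μ ≤ (optValue θ ν).toReal)
    (h : IsOptimal θ ν μ) : lagrangian θ ν g μ = (optValue θ ν).toReal := by
  obtain ⟨hμ, hd⟩ := (mem_feasible_iff hν.le).1 h.1
  refine (hmax μ hμ).antisymm ?_
  rw [lagrangian, h.2]
  have := mul_nonneg hg (sub_nonneg.2 hd)
  linarith

theorem PointwiseKKT.kktMean_le (h : PointwiseKKT θ ν g ρ) (hμ : HasMean μ) :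
    kktMean θ ν g μ ρ ≤ (optValue θ ν).toReal :=
  (integral_mono (hμ.integrable_kktFun θ ν g ρ) (integrable_const _) h.1).trans (by simp)

/-- Dirac laws give the upper bound at each point. The nonnegative deficit then has mean zero under
ρ, and continuity extends its vanishing from almost everywhere to the support. -/
theorem HasMean.pointwiseKKT (hρ : HasMean ρ)
    (hle : ∀ μ, HasMean μ → kktMean θ ν g μ ρ ≤ (optValue θ ν).toReal)
    (heq : lagrangian θ ν g ρ = (optValue θ ν).toReal) : PointwiseKKT θ ν g ρ := by
  have h1 : ∀ x, kktFun θ ν g ρ x ≤ (optValue θ ν).toReal := fun x => by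
    have := hle _ (hasMean_diracLaw x)
    rwa [kktMean, integral_diracLaw] at this
  refine ⟨h1, fun x hx => ?_⟩
  have hi := hρ.integrable_kktFun θ ν g ρ
  have h0 : ∫ x, ((optValue θ ν).toReal - kktFun θ ν g ρ x) ∂(ρ : Measure ℝ≥0) = 0 := by
    rw [integral_sub (integrable_const _) hi]
    change _ - kktMean θ ν g ρ ρ = 0
    rw [hρ.kktMean_self, heq]
    simp
  rw [integral_eq_zero_iff_of_nonneg (fun x => sub_nonneg.2 (h1 x))
    ((integrable_const _).sub' hi)] at h0
  have hcl : IsClosed {x | kktFun θ ν g ρ x = (optValue θ ν).toReal} :=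
    isClosed_eq (continuous_kktFun θ ν g ρ) continuous_const
  exact Measure.support_subset_of_isClosed hcl
    (h0.mono fun x hx => (sub_eq_zero.1 hx).symm) hx

theorem tendsto_optValue_toReal (θ : ℝ) :
    Tendsto (fun ν => (optValue θ ν).toReal) (𝓝[>] 0) (𝓝 0) := by
  have hc : Continuous fun ν : ℝ => θ ^ 2 * (2 * √ν + ν) := by fun_prop
  have h := (hc.tendsto 0).mono_left (nhdsWithin_le_nhds (s := Set.Ioi 0))
  simp only [Real.sqrt_zero, mul_zero, add_zero] at h
  refine squeeze_zero' (.of_forall fun ν => ENNReal.toReal_nonneg) ?_ h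
  filter_upwards [self_mem_nhdsWithin] with ν hν
  have hν' : 0 < ν := hν
  exact ENNReal.toReal_le_of_le_ofReal (by positivity) (optValue_le hν' θ)

/-- For every price `K` some input law has a positive gain `I - K D`. -/
theorem exists_pos_gain (hθ : θ ≠ 0) {K : ℝ} (hK : 0 ≤ K) :
    ∃ μ, HasMean μ ∧ 0 < (mutualInfo θ μ).toReal - K * (wardenDiv μ).toReal := by
  obtain ⟨s, hs0, hs⟩ := exists_seq_unitInterval
  have h0 := hasMean_diracLaw 0
  have h1 := hasMean_diracLaw 1
  -- This is the derivative of the gain at δ₀ towards δ₁. The warden's part cancels, whatever K is,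
  -- leaving θ² - log(1 + θ²) > 0.
  have hpos : 0 < kktMean θ 0 K (diracLaw 1) (diracLaw 0) := by
    have hl := Real.log_lt_sub_one_of_pos (scale_pos θ 1) (by
      have : 0 < θ ^ 2 := by positivity
      simp [scale, this.ne'])
    have e1 : scale θ 0 = 1 := by simp [scale]
    have e2 : scale 1 0 = 1 := by simp [scale]
    rw [kktMean, h1.integral_kktFun, h1.cross_diracLaw, h1.cross_diracLaw, integral_diracLaw,
      integral_diracLaw, integral_diracLaw, e1, e2]
    simp only [Real.log_one]
    linarith
  obtain ⟨n, hn⟩ := ((tendsto_kktMean_mix h1 θ 0 K (diracLaw 0) (diracLaw 1) hs).eventually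
    (lt_mem_nhds hpos)).exists
  refine ⟨_, h0.mix h1 (s n), ?_⟩
  have hl := h0.le_lagrangian_mix h1 hK (s n) θ 0
  have hz : 0 ≤ lagrangian θ 0 K (diracLaw 0) := by
    rw [lagrangian, wardenDiv_diracLaw_zero]
    simp
  have h3 := mul_nonneg (sub_nonneg.2 (s n).2.2) hz
  have h4 := mul_pos (hs0 n) hn
  rw [lagrangian.eq_def _ _ _ (CovertRayleigh.mix _ _ _), sub_zero] at hl
  linarith

end Lagrangian

theorem exists_multiplier_function (θ : ℝ) : ∃ γ : ℝ → ℝ, ∀ ν, 0 < ν → 0 ≤ γ ν ∧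
    ∀ μ, HasMean μ → lagrangian θ ν (γ ν) μ ≤ (optValue θ ν).toReal := by
  classical
  choose g hg using fun ν : Set.Ioi (0 : ℝ) => exists_multiplier θ (Set.mem_Ioi.1 ν.2)
  refine ⟨fun ν => if h : 0 < ν then g ⟨ν, h⟩ else 0, fun ν hν => ?_⟩
  simp only [hν, dif_pos]
  exact hg ⟨ν, hν⟩

/-! ### Behaviour of the multiplier and characterization of the optimal law -/

section Multiplier

variable {θ ν g : ℝ} {μ₁ μs : ProbabilityMeasure ℝ≥0} {γ : ℝ → ℝ}

/-- Only the test law μs is needed: the bound there is the equality case of Gibbs. -/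
theorem HasMean.eq_optimal_of_kktMean_le (h₁ : HasMean μ₁) (hs : HasMean μs) (hg : 0 ≤ g)
    (hθ : θ ≠ 0) (hLs : lagrangian θ ν g μs = (optValue θ ν).toReal)
    (hle : ∀ μ, HasMean μ → kktMean θ ν g μ μ₁ ≤ (optValue θ ν).toReal) : μ₁ = μs :=
  (hs.eq_of_kktMean_le h₁ hg hθ ((hle μs hs).trans_eq hLs.symm)).symm

/-- A fixed law with positive gain at price K would, at any lower multiplier, push the Lagrangian
above the value, which tends to 0. -/
theorem tendsto_multiplier_atTop (hθ : θ ≠ 0) (hγ : ∀ ν, 0 < ν → 0 ≤ γ ν ∧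
    ∀ μ, HasMean μ → lagrangian θ ν (γ ν) μ ≤ (optValue θ ν).toReal) :
    Tendsto γ (𝓝[>] 0) atTop := by
  refine tendsto_atTop.2 fun K => ?_
  obtain ⟨μ, hμ, hpos⟩ := exists_pos_gain hθ (le_max_right K 0)
  filter_upwards [(tendsto_optValue_toReal θ).eventually (gt_mem_nhds hpos),
    self_mem_nhdsWithin] with ν hA hν
  obtain ⟨h0, hmax⟩ := hγ ν hν
  have h1 := hmax μ hμ
  rw [lagrangian] at h1
  by_contra! hlt
  have hD : 0 ≤ (wardenDiv μ).toReal := ENNReal.toReal_nonneg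
  have h2 := mul_le_mul_of_nonneg_right (hlt.le.trans (le_max_left K 0)) hD
  have h3 := mul_nonneg h0 (le_of_lt hν)
  linarith

/-- The Lagrangian at δ₀ is at least γ(ν)ν, so this product is squeezed by the value. -/
theorem tendsto_multiplier_mul (hγ : ∀ ν, 0 < ν → 0 ≤ γ ν ∧
    ∀ μ, HasMean μ → lagrangian θ ν (γ ν) μ ≤ (optValue θ ν).toReal) :
    Tendsto (fun ν => γ ν * ν) (𝓝[>] 0) (𝓝 0) := by
  refine squeeze_zero' ?_ ?_ (tendsto_optValue_toReal θ)
  · filter_upwards [self_mem_nhdsWithin] with ν hν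
    exact mul_nonneg (hγ ν hν).1 (le_of_lt hν)
  · filter_upwards [self_mem_nhdsWithin] with ν hν
    have h1 := (hγ ν hν).2 _ (hasMean_diracLaw 0)
    rw [lagrangian, wardenDiv_diracLaw_zero, ENNReal.toReal_zero, zero_sub, mul_neg,
      sub_neg_eq_add] at h1
    have h2 : 0 ≤ (mutualInfo θ (diracLaw 0)).toReal := ENNReal.toReal_nonneg
    linarith

end Multiplier

end CovertRayleigh

end

/-! ### The main theorem -/

theorem theorem2 (θ : ℝ) (hθ : 0 < θ) :
    -- all quantities in the statement are finite and all integrals converge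
    (∀ μ ∈ CovertRayleigh.inputLaws, CovertRayleigh.mutualInfo θ μ < ∞) ∧
    (∀ ν : ℝ, 0 < ν → CovertRayleigh.optValue θ ν < ∞) ∧
    (∀ μ₁ ∈ CovertRayleigh.inputLaws, ∀ x : ℝ≥0,
      IntegrableOn (CovertRayleigh.mainIntegrand θ μ₁ x) (Set.Ioi 0) ∧
      IntegrableOn (CovertRayleigh.wardenIntegrand μ₁ x) (Set.Ioi 0)) ∧
    ∃ γ : ℝ → ℝ,
      (∀ ν : ℝ, 0 < ν →
        0 ≤ γ ν ∧
        (∀ μ₁ ∈ CovertRayleigh.inputLaws, ∀ μ ∈ CovertRayleigh.inputLaws,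
          Integrable (CovertRayleigh.kktFun θ ν (γ ν) μ₁) (μ : Measure ℝ≥0)) ∧
        ∃ μs : ProbabilityMeasure ℝ≥0,
          -- `μs` is the unique solution of the constrained problem
          (∀ μ : ProbabilityMeasure ℝ≥0, CovertRayleigh.IsOptimal θ ν μ ↔ μ = μs) ∧
          -- part 1
          IsGreatest (CovertRayleigh.lagrangian θ ν (γ ν) '' CovertRayleigh.inputLaws)
            (CovertRayleigh.optValue θ ν).toReal ∧
          (∀ μ ∈ CovertRayleigh.inputLaws,
            CovertRayleigh.lagrangian θ ν (γ ν) μ = (CovertRayleigh.optValue θ ν).toReal ↔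
              μ = μs) ∧
          -- part 2
          (∀ μ ∈ CovertRayleigh.inputLaws,
            ∫ x, CovertRayleigh.kktFun θ ν (γ ν) μs x ∂(μ : Measure ℝ≥0)
              ≤ (CovertRayleigh.optValue θ ν).toReal) ∧
          -- part 3
          (∀ μ₁ ∈ CovertRayleigh.inputLaws,
            (∀ μ ∈ CovertRayleigh.inputLaws,
              ∫ x, CovertRayleigh.kktFun θ ν (γ ν) μ₁ x ∂(μ : Measure ℝ≥0)
                ≤ (CovertRayleigh.optValue θ ν).toReal) ↔
              CovertRayleigh.PointwiseKKT θ ν (γ ν) μ₁) ∧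
          (∀ μ₁ ∈ CovertRayleigh.inputLaws,
            CovertRayleigh.IsOptimal θ ν μ₁ ↔ CovertRayleigh.PointwiseKKT θ ν (γ ν) μ₁)) ∧
      -- part 4
      Tendsto γ (𝓝[>] 0) atTop ∧
      Tendsto (fun ν : ℝ => γ ν * ν) (𝓝[>] 0) (𝓝 0) := by
  have hθ0 := hθ.ne'
  obtain ⟨γ, hγ⟩ := CovertRayleigh.exists_multiplier_function θ
  simp only [CovertRayleigh.mem_inputLaws_iff]
  refine ⟨fun μ hμ => CovertRayleigh.mutualInfo_lt_top hμ θ,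
    fun ν hν => CovertRayleigh.optValue_lt_top hν θ,
    fun μ₁ _ x => ⟨CovertRayleigh.integrable_mainIntegrand θ μ₁ x,
      CovertRayleigh.integrable_wardenIntegrand μ₁ x⟩, γ, fun ν hν => ?_,
    CovertRayleigh.tendsto_multiplier_atTop hθ0 hγ, CovertRayleigh.tendsto_multiplier_mul hγ⟩
  obtain ⟨hg, hmax⟩ := hγ ν hν
  obtain ⟨μs, hopt⟩ := CovertRayleigh.exists_isOptimal θ hν
  have hs := ((CovertRayleigh.mem_feasible_iff hν.le).1 hopt.1).1
  have hLs := hopt.lagrangian_eq hν hg hmax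
  have huniq : ∀ μ, CovertRayleigh.HasMean μ → CovertRayleigh.lagrangian θ ν (γ ν) μ
      = (CovertRayleigh.optValue θ ν).toReal → μ = μs := fun μ hμ h =>
    hμ.eq_of_lagrangian_eq hs hg hθ0 hmax h hLs
  have hiff : ∀ μ, CovertRayleigh.IsOptimal θ ν μ ↔ μ = μs := fun μ =>
    ⟨fun h => huniq μ ((CovertRayleigh.mem_feasible_iff hν.le).1 h.1).1
      (h.lagrangian_eq hν hg hmax), fun h => h ▸ hopt⟩
  have hfirst : ∀ μ, CovertRayleigh.HasMean μ → CovertRayleigh.kktMean θ ν (γ ν) μ μs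
      ≤ (CovertRayleigh.optValue θ ν).toReal := fun μ hμ =>
    (hs.kktMean_le_of_isMax hμ hg fun μ' h' => (hmax μ' h').trans_eq hLs.symm).trans_eq hLs
  refine ⟨hg, fun μ₁ _ μ hμ => hμ.integrable_kktFun θ ν (γ ν) μ₁, μs, hiff, ⟨?_, ?_⟩,
    fun μ hμ => ⟨huniq μ hμ, fun h => h ▸ hLs⟩, hfirst, fun μ₁ h₁ => ⟨fun h => ?_,
      fun h μ hμ => h.kktMean_le hμ⟩, fun μ₁ h₁ => ⟨fun h => ?_, fun h => ?_⟩⟩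
  · exact ⟨μs, (CovertRayleigh.mem_inputLaws_iff μs).2 hs, hLs⟩
  · rintro _ ⟨μ, hμ, rfl⟩
    exact hmax μ ((CovertRayleigh.mem_inputLaws_iff μ).1 hμ)
  -- The averaged condition first identifies μ₁ with μs; only then is its Lagrangian known to equal
  -- the value, as the equality on the support requires.
  · obtain rfl := h₁.eq_optimal_of_kktMean_le hs hg hθ0 hLs h
    exact h₁.pointwiseKKT h hLs
  · obtain rfl := (hiff μ₁).1 h
    exact h₁.pointwiseKKT hfirst hLs
  · exact (hiff μ₁).2 (h₁.eq_optimal_of_kktMean_le hs hg hθ0 hLs fun μ hμ => h.kktMean_le hμ)
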